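/- **Theorem (Denotational model for xCL).** *Setting.* Let $\mathcal{C}=\mathbf{Set}^{\omega^{\mathrm{op}}}$ be the topos of trees: objects are families $(X_n)_{n\in\omega}$ of sets with restriction maps $X_n\to X_m$ ($m\le n$). Let $\triangleright$ be the later modality ($\triangleright_0X=1$, $\triangleright_{n+1}X=X_n$), with the canonical maps $\mathsf{next}_n\colon X_n\to\triangleright_nX$, and recall that $(Y^X)_n$ is the set of tuples $(f_i\colon X_i\to Y_i)_{0\le i\le n}$ commuting with restrictions. Put $$B(X,Y)=\triangleright Y+(\triangleright Y)^{\triangleright X}.$$ The language xCL has the terms $p,q::=S\mid K\mid I\mid S'(p)\mid K'(p)\mid S''(p,q)\mid p\,q$ and the transitions $$S\xrightarrow{t}S'(t),\quad S'(p)\xrightarrow{t}S''(p,t),\quad S''(p,q)\xrightarrow{t}(p\,t)(q\,t),\quad K\xrightarrow{t}K'(t),\quad K'(p)\xrightarrow{t}p,\quad I\xrightarrow{t}t,$$ $p\,q\to p'\,q$ if $p\to p'$, and $p\,q\to p'$ if $p\xrightarrow{q}p'$. Let $\Sigma\colon\mathcal{C}\to\mathcal{C}$ be the corresponding polynomial functor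 applied stagewise, $\Sigma^\star$ its free monad, and $\mu\Sigma$ its initial algebra (the constant presheaf of closed terms). These rules define a higher-order GSOS law, i.e. a family $\rho_{X,Y}\colon\Sigma(X\times B(X,Y))\to B(X,\Sigma^\star(X+Y))$, dinatural in $X$ and natural in $Y$. Concretely, at stage $n$, with all variables from $X$ and $Y$ delayed by one step (so that the resulting term is the unique element of $1$ at stage $0$ of $\triangleright\Sigma^\star(X+Y)$): $\rho$ sends $(p,f)\,(q,g)$ to the application of $f$ to $\mathsf{next}_n(q)$ if $f\in\triangleright_nY$, and to $f_n(\mathsf{next}_n(q))$ if $f\in((\triangleright Y)^{\triangleright X})_n$; it sends $S''((p,f),(q,g))$ to the tuple of maps $t\mapsto(p\,t)(q\,t)$ (with $p,q$ restricted), and similarly for the other combinators. Let $\gamma\colon\mu\Sigma\to B(\mu\Sigma,\mu\Sigma)$ be the operational model of $\rho$, that is, the unique $\gamma$ making $(\mu\Sigma,\iota,\gamma)$ a $\rho$-bialgebra, where $\Sigma X\xrightarrow{a}X\xrightarrow{c}B(X,X)$ is a $\rho$-bialgebra if $$c\cdot a=B(\mathrm{id},\hat a\cdot\Sigma^\star\nabla)\cdot\rho_{X,X}\cdot\Sigma\langle\mathrm{id},c\rangle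 ,$$ $\hat a\colon\Sigma^\star X\to X$ being the evaluation of terms in $(X,a)$. A coalgebra $z\colon Z\to B(Z,Z)$ is *locally final* if it is a final coalgebra for the endofunctor $B(Z,-)$. A *denotational model* is a $\rho$-bialgebra whose coalgebra is locally final. Write $\mathsf{beh}\colon\mu\Sigma\to\nu B(\mu\Sigma,-)$ for the unique coalgebra morphism from $(\mu\Sigma,\gamma)$ to the final $B(\mu\Sigma,-)$-coalgebra. A $\Sigma$-algebra $(A,a)$ is *adequate* if $\mathsf{beh}$ factorizes through the unique algebra morphism $[\![-]\!]\colon\mu\Sigma\to A$. *Step-indexed strong applicative bisimilarity* is the greatest $\omega$-indexed family $(\sim_n)_{n\in\omega}$ of equivalence relations on closed xCL-terms such that $p\sim_{n+1}q$ implies: $p\sim_nq$; if $p\to p'$ then $q\to q'$ for some $q'\sim_np'$; and if $p\xrightarrow{t}p'$ then $q\xrightarrow{t}q'$ for some $q'\sim_np'$. *Statement.* 1. $B$ has a locally final coalgebra $Z\cong B(Z,Z)$, given by the presheaf $Z$ of guarded interaction trees: $Z_0=1+1$, and $Z_{n+1}$ is the disjoint union of $Z_n$ and the set of tuples $(f_i\colon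 Z_i\to Z_i)_{0\le i\le n}$ commuting with the restriction maps. The restriction map $Z_1\to Z_0$ preserves the summand; for $n\ge1$ the map $Z_{n+1}\to Z_n$ restricts trees and truncates tuples to $(f_0,\dots,f_{n-1})$. The coalgebra structure identifies $Z_0$ with $1+1^1$, and at stage $n+1$ sends trees and tuples to themselves. 2. Every locally final coalgebra $z\colon Z\to B(Z,Z)$, in particular the one above, extends to a denotational model $\Sigma Z\xrightarrow{a}Z\xrightarrow{z}B(Z,Z)$ such that $(Z,a)$ is adequate, and such that for all closed terms $p,q$ and all $n$, $[\![p]\!]_n=[\![q]\!]_n$ implies $p\sim_nq$. 3. The final coalgebra $\nu B(\mu\Sigma,-)$ exists, and behavioural equivalence on the operational model is step-indexed strong applicative bisimilarity: $\mathsf{beh}_n(p)=\mathsf{beh}_n(q)$ if and only if $p\sim_{n+1}q$. -/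

import Mathlib

open CategoryTheory Opposite

universe u

namespace XCL

/-! ### The topos of trees -/

/-- The topos of trees: presheaves of sets on the poset `ω = {0 ≤ 1 ≤ 2 ≤ ⋯}`. -/
abbrev ToT : Type (u + 1) := ℕᵒᵖ ⥤ Type u

/-- The set `X_n`. -/
abbrev St (X : ToT.{u}) (n : ℕ) : Type u := X.obj (op n)

/-- The restriction map `X_{n,m} : X_n → X_m` for `m ≤ n`. -/
def res (X : ToT.{u}) {m n : ℕ} (h : m ≤ n) (x : St X n) : St X m :=
  X.map (homOfLE h).op x

/-- The component at stage `n` of a morphism. -/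
def ap {X Y : ToT.{u}} (f : X ⟶ Y) (n : ℕ) (x : St X n) : St Y n := f.app (op n) x

@[simp] theorem res_refl (X : ToT.{u}) {n : ℕ} (h : n ≤ n) (x : St X n) : res X h x = x := by
  simp [res]

@[simp] theorem res_res (X : ToT.{u}) {k m n : ℕ} (h : k ≤ m) (h' : m ≤ n) (x : St X n) :
    res X h (res X h' x) = res X (h.trans h') x := by
  have : (homOfLE (h.trans h')).op = (homOfLE h').op ≫ (homOfLE h).op := rfl
  simp [res, this]

theorem ap_res {X Y : ToT.{u}} (f : X ⟶ Y) {m n : ℕ} (h : m ≤ n) (x : St X n) :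
    ap f m (res X h x) = res Y h (ap f n x) :=
  NatTrans.naturality_apply f (homOfLE h).op x

@[simp] theorem ap_id (X : ToT.{u}) (n : ℕ) (x : St X n) : ap (𝟙 X) n x = x := rfl

@[simp] theorem ap_comp {X Y Z : ToT.{u}} (f : X ⟶ Y) (g : Y ⟶ Z) (n : ℕ) (x : St X n) :
    ap (f ≫ g) n x = ap g n (ap f n x) := rfl

theorem hom_ext {X Y : ToT.{u}} {f g : X ⟶ Y} (h : ∀ n x, ap f n x = ap g n x) : f = g := by
  ext n x
  exact h n.unop x

/-- An object of the topos of trees from an indexed family of sets with restriction maps. -/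
def mkObj (A : ℕ → Type u) (r : ∀ {m n : ℕ}, m ≤ n → A n → A m)
    (r_refl : ∀ (n : ℕ) (x : A n), r (le_refl n) x = x)
    (r_trans : ∀ {k m n : ℕ} (h : k ≤ m) (h' : m ≤ n) (x : A n),
      r h (r h' x) = r (h.trans h') x) : ToT.{u} where
  obj n := A n.unop
  map f := ↾(r f.unop.le)
  map_id n := by ext x; exact r_refl _ x
  map_comp f g := by ext x; exact (r_trans g.unop.le f.unop.le x).symm

/-- A morphism of the topos of trees from its components. -/
def mkHom {X Y : ToT.{u}} (f : ∀ n, St X n → St Y n)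
    (hf : ∀ {m n : ℕ} (h : m ≤ n) (x : St X n), f m (res X h x) = res Y h (f n x)) : X ⟶ Y where
  app n := ↾(f n.unop)
  naturality m n g := by ext x; exact hf g.unop.le x

@[simp] theorem ap_mkHom {X Y : ToT.{u}} (f : ∀ n, St X n → St Y n) (hf) (n : ℕ) (x : St X n) :
    ap (mkHom f hf : X ⟶ Y) n x = f n x := rfl

/-- Binary products, `(X × Y)_n = X_n × Y_n`. -/
abbrev prd (X Y : ToT.{u}) : ToT.{u} := FunctorToTypes.prod X Y

/-- The morphism `f × g`. -/
def prdMap {X X' Y Y' : ToT.{u}} (f : X ⟶ X') (g : Y ⟶ Y') : prd X Y ⟶ prd X' Y' :=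
  FunctorToTypes.prod.lift (FunctorToTypes.prod.fst ≫ f) (FunctorToTypes.prod.snd ≫ g)

/-- Binary coproducts, `(X + Y)_n = X_n + Y_n`. -/
abbrev sm (X Y : ToT.{u}) : ToT.{u} := FunctorToTypes.coprod X Y

/-- The morphism `f + g`. -/
def smMap {X X' Y Y' : ToT.{u}} (f : X ⟶ X') (g : Y ⟶ Y') : sm X Y ⟶ sm X' Y' :=
  FunctorToTypes.coprod.desc (f ≫ FunctorToTypes.coprod.inl) (g ≫ FunctorToTypes.coprod.inr)

/-- The codiagonal `∇ : X + X ⟶ X`. -/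
def codiag (X : ToT.{u}) : sm X X ⟶ X := FunctorToTypes.coprod.desc (𝟙 X) (𝟙 X)

theorem ap_prdMap {X X' Y Y' : ToT.{u}} (f : X ⟶ X') (g : Y ⟶ Y') (n : ℕ) (x : St X n × St Y n) :
    ap (prdMap f g) n x = (ap f n x.1, ap g n x.2) := rfl

theorem ap_smMap {X X' Y Y' : ToT.{u}} (f : X ⟶ X') (g : Y ⟶ Y') (n : ℕ) (x : St X n ⊕ St Y n) :
    ap (smMap f g) n x = Sum.map (ap f n) (ap g n) x := by
  cases x <;> rfl

/-! ### The later modality -/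

/-- `▷_0 X = 1` and `▷_{n+1} X = X_n`. -/
def LaterSt (X : ToT.{u}) : ℕ → Type u
  | 0 => PUnit
  | n + 1 => St X n

/-- Restriction maps of `▷ X`. -/
def laterRes (X : ToT.{u}) : ∀ {m n : ℕ}, m ≤ n → LaterSt X n → LaterSt X m
  | 0, _, _, _ => PUnit.unit
  | _ + 1, 0, h, _ => absurd h (Nat.not_succ_le_zero _)
  | _ + 1, _ + 1, h, x => res X (Nat.le_of_succ_le_succ h) x

theorem laterRes_refl (X : ToT.{u}) :
    ∀ (n : ℕ) (x : LaterSt X n), laterRes X (le_refl n) x = x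
  | 0, _ => rfl
  | _ + 1, x => res_refl X _ x

theorem laterRes_trans (X : ToT.{u}) : ∀ {k m n : ℕ} (h : k ≤ m) (h' : m ≤ n) (x : LaterSt X n),
    laterRes X h (laterRes X h' x) = laterRes X (h.trans h') x
  | 0, _, _, _, _, _ => rfl
  | _ + 1, 0, _, h, _, _ => absurd h (Nat.not_succ_le_zero _)
  | _ + 1, _ + 1, 0, _, h', _ => absurd h' (Nat.not_succ_le_zero _)
  | _ + 1, _ + 1, _ + 1, _, _, x => res_res X _ _ x

/-- The object `▷ X`. -/
def laterObj (X : ToT.{u}) : ToT.{u} :=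
  mkObj (LaterSt X) (laterRes X) (laterRes_refl X) (laterRes_trans X)

/-- The components of `▷ f`. -/
def laterAp {X Y : ToT.{u}} (f : X ⟶ Y) : ∀ n, LaterSt X n → LaterSt Y n
  | 0, _ => PUnit.unit
  | n + 1, x => ap f n x

theorem laterAp_res {X Y : ToT.{u}} (f : X ⟶ Y) : ∀ {m n : ℕ} (h : m ≤ n) (x : LaterSt X n),
    laterAp f m (laterRes X h x) = laterRes Y h (laterAp f n x)
  | 0, _, _, _ => rfl
  | _ + 1, 0, h, _ => absurd h (Nat.not_succ_le_zero _)
  | _ + 1, _ + 1, _, x => ap_res f _ x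

/-- The later modality `▷`. -/
def later : ToT.{u} ⥤ ToT.{u} where
  obj := laterObj
  map f := mkHom (X := laterObj _) (Y := laterObj _) (laterAp f) (laterAp_res f)
  map_id X := hom_ext fun n x => by cases n <;> rfl
  map_comp f g := hom_ext fun n x => by cases n <;> rfl

/-- The canonical map `next_n : X_n → ▷_n X`, that is `X_{n+1} → X_n` at successor stages. -/
def next (X : ToT.{u}) : ∀ n, St X n → St (later.obj X) n
  | 0, _ => PUnit.unit
  | n + 1, x => res X (Nat.le_succ n) x

theorem next_res (X : ToT.{u}) : ∀ {m n : ℕ} (h : m ≤ n) (x : St X n),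
    next X m (res X h x) = res (later.obj X) h (next X n x)
  | 0, _, _, _ => rfl
  | _ + 1, 0, h, _ => absurd h (Nat.not_succ_le_zero _)
  | m + 1, n + 1, h, x => by
    change res X _ (res X _ x) = res X _ (res X _ x)
    rw [res_res, res_res]

theorem next_ap {X Y : ToT.{u}} (f : X ⟶ Y) : ∀ (n : ℕ) (x : St X n),
    next Y n (ap f n x) = ap (later.map f) n (next X n x)
  | 0, _ => rfl
  | n + 1, x => (ap_res f (Nat.le_succ n) x).symm

/-! ### Exponentials -/

/-- `(Y ^ X)_n`: the tuples `(f_i : X_i → Y_i)_{0 ≤ i ≤ n}` that commute with the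
restriction maps. -/
@[ext] structure ExpSt (X Y : ToT.{u}) (n : ℕ) : Type u where
  fn : ∀ i, i ≤ n → St X i → St Y i
  comm : ∀ {i j : ℕ} (hij : i ≤ j) (hj : j ≤ n) (x : St X j),
    fn i (hij.trans hj) (res X hij x) = res Y hij (fn j hj x)

/-- The exponential `Y ^ X`; restriction maps truncate tuples. -/
def expObj (X Y : ToT.{u}) : ToT.{u} :=
  mkObj (ExpSt X Y)
    (fun h f => ⟨fun i hi => f.fn i (hi.trans h), fun hij hj => f.comm hij (hj.trans h)⟩)
    (fun _ _ => rfl) (fun _ _ _ => rfl)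

/-- The functorial action `g ^ f : Y ^ X' ⟶ Y' ^ X` of `f : X ⟶ X'` and `g : Y ⟶ Y'`. -/
def expMap {X X' Y Y' : ToT.{u}} (f : X ⟶ X') (g : Y ⟶ Y') : expObj X' Y ⟶ expObj X Y' :=
  mkHom (X := expObj X' Y) (Y := expObj X Y')
    (fun _ φ =>
      ⟨fun i hi x => ap g i (ExpSt.fn φ i hi (ap f i x)), fun hij hj x => by
        rw [ap_res, ExpSt.comm φ hij hj, ap_res]⟩)
    (fun _ _ => rfl)

/-! ### The behaviour bifunctor -/

/-- The behaviour bifunctor `B(X, Y) = ▷ Y + (▷ Y) ^ (▷ X)`. -/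
def Bu : ToT.{u}ᵒᵖ ⥤ ToT.{u} ⥤ ToT.{u} where
  obj X :=
    { obj := fun Y => sm (later.obj Y) (expObj (later.obj X.unop) (later.obj Y))
      map := fun g => smMap (later.map g) (expMap (𝟙 _) (later.map g))
      map_id := fun Y => hom_ext fun n x => by
        rw [CategoryTheory.Functor.map_id]
        rcases x with x | x <;> rfl
      map_comp := fun f g => hom_ext fun n x => by
        rw [CategoryTheory.Functor.map_comp]
        rcases x with x | x <;> rfl }
  map f :=
    { app := fun Y => smMap (𝟙 _) (expMap (later.map f.unop) (𝟙 _))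
      naturality := fun Y Y' g => hom_ext fun n x => by rcases x with x | x <;> rfl }
  map_id X := by
    ext Y : 2
    refine hom_ext fun n x => ?_
    change ap (smMap _ (expMap (later.map (𝟙 X.unop)) _)) n x = x
    rw [CategoryTheory.Functor.map_id]
    rcases x with x | x <;> rfl
  map_comp f g := by
    ext Y : 2
    refine hom_ext fun n x => ?_
    change ap (smMap _ (expMap (later.map (g.unop ≫ f.unop)) _)) n x = _
    rw [CategoryTheory.Functor.map_comp]
    rcases x with x | x <;> rfl

/-! ### Higher-order abstract GSOS over the topos of trees -/

/-- A higher-order coalgebra `z : Z ⟶ B(Z, Z)` is locally final if it is a final coalgebra for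
the endofunctor `B(Z, -)`. -/
def IsLocallyFinal (B : ToT.{u}ᵒᵖ ⥤ ToT.{u} ⥤ ToT.{u}) (Z : ToT.{u})
    (z : Z ⟶ (B.obj (op Z)).obj Z) : Prop :=
  Nonempty (Limits.IsTerminal (⟨Z, z⟩ : Endofunctor.Coalgebra (B.obj (op Z))))

/-- Free `S`-algebras on all objects. -/
structure FreeAlgebras (S : ToT.{u} ⥤ ToT.{u}) where
  alg : ToT.{u} → Endofunctor.Algebra S
  unit : ∀ X, X ⟶ (alg X).a
  lift : ∀ {X : ToT.{u}} (A : Endofunctor.Algebra S), (X ⟶ A.a) → (alg X ⟶ A)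
  unit_lift : ∀ {X : ToT.{u}} (A : Endofunctor.Algebra S) (h : X ⟶ A.a),
    unit X ≫ (lift A h).f = h
  lift_unique : ∀ {X : ToT.{u}} (A : Endofunctor.Algebra S) (h : X ⟶ A.a) (k : alg X ⟶ A),
    unit X ≫ k.f = h → k = lift A h

/-- The functor `S⋆` underlying the free monad. -/
def FreeAlgebras.star {S : ToT.{u} ⥤ ToT.{u}} (F : FreeAlgebras S) : ToT.{u} ⥤ ToT.{u} where
  obj X := (F.alg X).a
  map {X Y} f := (F.lift (F.alg Y) (f ≫ F.unit Y)).f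
  map_id X := by
    rw [← F.lift_unique (F.alg X) (𝟙 X ≫ F.unit X) (𝟙 _) (by simp)]
    rfl
  map_comp {X Y Z} f g := by
    rw [← F.lift_unique (F.alg Z) ((f ≫ g) ≫ F.unit Z)
      (F.lift (F.alg Y) (f ≫ F.unit Y) ≫ F.lift (F.alg Z) (g ≫ F.unit Z))]
    · rfl
    · rw [Endofunctor.Algebra.comp_f, ← Category.assoc, F.unit_lift, Category.assoc, F.unit_lift,
        Category.assoc]

/-- The Eilenberg-Moore algebra `S⋆ A ⟶ A` induced by an `S`-algebra. -/
def FreeAlgebras.hat {S : ToT.{u} ⥤ ToT.{u}} (F : FreeAlgebras S) (A : Endofunctor.Algebra S) :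
    F.star.obj A.a ⟶ A.a :=
  (F.lift A (𝟙 A.a)).f

/-- A higher-order GSOS law of `S` over `B`: a family
`ρ_{X,Y} : S (X × B(X, Y)) ⟶ B(X, S⋆ (X + Y))` natural in `Y` and dinatural in `X`. -/
structure HOGSOSLaw (S : ToT.{u} ⥤ ToT.{u}) (F : FreeAlgebras S)
    (B : ToT.{u}ᵒᵖ ⥤ ToT.{u} ⥤ ToT.{u}) where
  rho : ∀ X Y : ToT.{u},
    S.obj (prd X ((B.obj (op X)).obj Y)) ⟶ (B.obj (op X)).obj (F.star.obj (sm X Y))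
  natural : ∀ (X : ToT.{u}) {Y Y' : ToT.{u}} (g : Y ⟶ Y'),
    S.map (prdMap (𝟙 X) ((B.obj (op X)).map g)) ≫ rho X Y' =
      rho X Y ≫ (B.obj (op X)).map (F.star.map (smMap (𝟙 X) g))
  dinatural : ∀ {X X' : ToT.{u}} (f : X ⟶ X') (Y : ToT.{u}),
    S.map (prdMap f (𝟙 ((B.obj (op X')).obj Y))) ≫ rho X' Y ≫
        (B.map f.op).app (F.star.obj (sm X' Y)) =
      S.map (prdMap (𝟙 X) ((B.map f.op).app Y)) ≫ rho X Y ≫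
        (B.obj (op X)).map (F.star.map (smMap f (𝟙 Y)))

/-- `(X, a, c)` is a `ρ`-bialgebra:
`c · a = B(id, â · S⋆ ∇) · ρ_{X,X} · S ⟨id, c⟩`. -/
def IsBialgebra {S : ToT.{u} ⥤ ToT.{u}} {F : FreeAlgebras S} {B : ToT.{u}ᵒᵖ ⥤ ToT.{u} ⥤ ToT.{u}}
    (L : HOGSOSLaw S F B) (X : ToT.{u}) (a : S.obj X ⟶ X) (c : X ⟶ (B.obj (op X)).obj X) : Prop :=
  a ≫ c = S.map (FunctorToTypes.prod.lift (𝟙 X) c) ≫ L.rho X X ≫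
    (B.obj (op X)).map (F.star.map (codiag X) ≫ F.hat ⟨X, a⟩)

/-- A denotational model for the law: a `ρ`-bialgebra whose higher-order coalgebra is locally
final. -/
def IsDenotationalModel {S : ToT.{u} ⥤ ToT.{u}} {F : FreeAlgebras S}
    {B : ToT.{u}ᵒᵖ ⥤ ToT.{u} ⥤ ToT.{u}} (L : HOGSOSLaw S F B) (X : ToT.{u}) (a : S.obj X ⟶ X)
    (c : X ⟶ (B.obj (op X)).obj X) : Prop :=
  IsBialgebra L X a c ∧ IsLocallyFinal B X c

/-! ### Syntax of xCL -/

/-- The polynomial set functor `1 + 1 + 1 + X + X + X × X + X × X`; the constructors `S₁`, `S₂`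
and `K₁` stand for `S'`, `S''` and `K'`. -/
inductive Sig (X : Type u) : Type u
  | S : Sig X
  | K : Sig X
  | I : Sig X
  | S₁ : X → Sig X
  | K₁ : X → Sig X
  | S₂ : X → X → Sig X
  | app : X → X → Sig X

/-- Functorial action of `Sig`. -/
def Sig.map {X Y : Type u} (f : X → Y) : Sig X → Sig Y
  | S => S
  | K => K
  | I => I
  | S₁ p => S₁ (f p)
  | K₁ p => K₁ (f p)
  | S₂ p q => S₂ (f p) (f q)
  | app p q => app (f p) (f q)

/-- The syntax endofunctor on the topos of trees, given pointwise by `Sig`. -/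
def Su : ToT.{u} ⥤ ToT.{u} where
  obj X := mkObj (fun n => Sig (St X n)) (fun h => Sig.map (res X h))
    (fun n x => by cases x <;> simp [Sig.map]) (fun h h' x => by cases x <;> simp [Sig.map])
  map {X Y} f := mkHom
    (X := mkObj (fun n => Sig (St X n)) (fun h => Sig.map (res X h)) _ _)
    (Y := mkObj (fun n => Sig (St Y n)) (fun h => Sig.map (res Y h)) _ _)
    (fun n => Sig.map (ap f n))
    (fun h x => by
      change Sig.map (ap f _) (Sig.map (res X h) x) = Sig.map (res Y h) (Sig.map (ap f _) x)
      cases x <;> simp [Sig.map, ap_res])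
  map_id X := hom_ext fun n x => by cases x <;> rfl
  map_comp f g := hom_ext fun n x => by cases x <;> rfl

/-- xCL-terms with variables from `V`. -/
inductive Term (V : Type u) : Type u
  | var : V → Term V
  | S : Term V
  | K : Term V
  | I : Term V
  | S₁ : Term V → Term V
  | K₁ : Term V → Term V
  | S₂ : Term V → Term V → Term V
  | app : Term V → Term V → Term V

/-- The algebra structure on terms. -/
def Term.op {V : Type u} : Sig (Term V) → Term V
  | .S => S
  | .K => K
  | .I => I
  | .S₁ p => S₁ p
  | .K₁ p => K₁ p
  | .S₂ p q => S₂ p q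
  | .app p q => app p q

/-- Evaluation of terms in an algebra. -/
def Term.eval {V A : Type u} (a : Sig A → A) (v : V → A) : Term V → A
  | var x => v x
  | S => a .S
  | K => a .K
  | I => a .I
  | S₁ p => a (.S₁ (p.eval a v))
  | K₁ p => a (.K₁ (p.eval a v))
  | S₂ p q => a (.S₂ (p.eval a v) (q.eval a v))
  | app p q => a (.app (p.eval a v) (q.eval a v))

/-- Renaming of variables. -/
def Term.map {V W : Type u} (f : V → W) : Term V → Term W := Term.eval Term.op (fun x => var (f x))

theorem Term.eval_op {V A : Type u} (a : Sig A → A) (v : V → A) (t : Sig (Term V)) :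
    (Term.op t).eval a v = a (t.map (Term.eval a v)) := by
  cases t <;> rfl

theorem Term.eval_hom {V A A' : Type u} (a : Sig A → A) (a' : Sig A' → A') (v : V → A) (k : A → A')
    (hk : ∀ s, k (a s) = a' (s.map k)) (t : Term V) :
    k (t.eval a v) = t.eval a' (fun x => k (v x)) := by
  induction t with
  | var x => rfl
  | S => exact hk _
  | K => exact hk _
  | I => exact hk _
  | S₁ p ihp => simp only [eval, hk, Sig.map, ihp]
  | K₁ p ihp => simp only [eval, hk, Sig.map, ihp]
  | S₂ p q ihp ihq => simp only [eval, hk, Sig.map, ihp, ihq]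
  | app p q ihp ihq => simp only [eval, hk, Sig.map, ihp, ihq]

theorem Term.eval_map {V W A : Type u} (a : Sig A → A) (v : W → A) (f : V → W) (t : Term V) :
    (t.map f).eval a v = t.eval a (fun x => v (f x)) :=
  Term.eval_hom Term.op a _ (Term.eval a v) (Term.eval_op a v) t

theorem Term.eval_self {V : Type u} (t : Term V) : t.eval Term.op Term.var = t := by
  induction t with
  | var x => rfl
  | S => rfl
  | K => rfl
  | I => rfl
  | S₁ p ihp => simp only [eval, op, ihp]
  | K₁ p ihp => simp only [eval, op, ihp]
  | S₂ p q ihp ihq => simp only [eval, op, ihp, ihq]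
  | app p q ihp ihq => simp only [eval, op, ihp, ihq]

/-- The object of terms, `(Σ⋆ X)_n` being the set of terms with variables from `X_n`. -/
def termObj (X : ToT.{u}) : ToT.{u} :=
  mkObj (fun n => Term (St X n)) (fun h => Term.map (res X h))
    (fun n t => by
      simp only [Term.map, res_refl]
      exact t.eval_self)
    (fun h h' t => by
      rw [Term.map, Term.eval_map]
      simp only [Term.map, res_res])

/-- The free algebra on `X`. -/
def termAlg (X : ToT.{u}) : Endofunctor.Algebra Su.{u} where
  a := termObj X
  str := mkHom (X := Su.obj (termObj X)) (Y := termObj X) (fun _ t => Term.op t)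
    (fun _ t => (Term.eval_op Term.op _ t).symm)

theorem alg_res (A : Endofunctor.Algebra Su.{u}) {m n : ℕ} (h : m ≤ n) (s : Sig (St A.a n)) :
    res A.a h (ap A.str n s) = ap A.str m (s.map (res A.a h)) :=
  (ap_res A.str h s).symm

theorem hom_alg {A A' : Endofunctor.Algebra Su.{u}} (k : A ⟶ A') (n : ℕ) (s : Sig (St A.a n)) :
    ap k.f n (ap A.str n s) = ap A'.str n (s.map (ap k.f n)) := by
  have h : ap (Su.map k.f ≫ A'.str) n s = ap (A.str ≫ k.f) n s := by rw [k.h]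
  exact h.symm

/-- The free algebras of the syntax endofunctor. -/
def freeU : FreeAlgebras Su.{u} where
  alg := termAlg
  unit X := mkHom (X := X) (Y := termObj X) (fun _ x => Term.var x) (fun _ _ => rfl)
  lift {X} A v :=
    { f := mkHom (X := termObj X) (Y := A.a) (fun n t => t.eval (ap A.str n) (ap v n))
        (fun {m n} hmn t => by
          rw [Term.eval_hom (ap A.str n) (ap A.str m) (ap v n) (res A.a hmn) (alg_res A hmn) t]
          refine (Term.eval_map _ _ _ t).trans ?_
          simp only [ap_res])
      h := hom_ext fun _ t => (Term.eval_op _ _ t).symm }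
  unit_lift _ _ := rfl
  lift_unique {X} A _ k hk := by
    subst hk
    ext : 1
    exact hom_ext fun n t => (congrArg (ap k.f n) (Term.eval_self t)).symm.trans
      (Term.eval_hom Term.op (ap A.str n) Term.var (ap k.f n) (hom_alg k n) t)

/-- Programs: closed xCL-terms. -/
abbrev Prog : Type u := Term PEmpty.{u + 1}

/-- The initial algebra: the constant presheaf of programs. -/
def muAlg : Endofunctor.Algebra Su.{u} where
  a := mkObj (fun _ => Prog.{u}) (fun _ p => p) (fun _ _ => rfl) (fun _ _ _ => rfl)
  str := mkHom (X := Su.obj (mkObj (fun _ => Prog.{u}) (fun _ p => p) _ _))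
    (Y := mkObj (fun _ => Prog.{u}) (fun _ p => p) _ _)
    (fun _ t => Term.op t) (fun _ t => by cases t <;> rfl)

/-- The object `μΣ` of programs. -/
abbrev Mu : ToT.{u} := muAlg.a

/-- `muAlg` is an initial algebra. -/
def muInitial : Limits.IsInitial muAlg.{u} :=
  Limits.IsInitial.ofUniqueHom
    (fun A =>
      { f := mkHom (X := Mu) (Y := A.a) (fun n p => Term.eval (ap A.str n) PEmpty.elim p)
          (fun {m n} h t => (congrArg (fun v => Term.eval (ap A.str m) v t)
            (funext fun x => x.elim)).trans
            (Term.eval_hom (ap A.str n) (ap A.str m) _ (res A.a h) (alg_res A h) t).symm)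
        h := hom_ext fun n t => (Term.eval_op _ _ t).symm })
    (fun A k => by
      ext : 1
      refine hom_ext fun n (t : Prog) => ?_
      refine ((congrArg (ap k.f n) (Term.eval_self t)).symm.trans
        (Term.eval_hom Term.op (ap A.str n) Term.var (ap k.f n) (hom_alg k n) t)).trans ?_
      exact congrArg (fun v => Term.eval (ap A.str n) v t) (funext fun x => x.elim))

/-- The denotation map `⟦-⟧ : μΣ ⟶ A`, the unique algebra morphism. -/
def den (A : Endofunctor.Algebra Su.{u}) : Mu ⟶ A.a := (muInitial.to A).f

/-! ### The higher-order GSOS law of xCL -/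

/-- The canonical map `(Σ⋆ (▷ X + ▷ Y))_n → ▷_n Σ⋆ (X + Y)`: the identity at successor stages. -/
def delay (X Y : ToT.{u}) : ∀ n, Term (St (later.obj X) n ⊕ St (later.obj Y) n) →
    St (later.obj (freeU.star.obj (sm X Y))) n
  | 0, _ => PUnit.unit
  | _ + 1, t => t

theorem delay_res (X Y : ToT.{u}) : ∀ {m n : ℕ} (h : m ≤ n)
    (t : Term (St (later.obj X) n ⊕ St (later.obj Y) n)),
    delay X Y m (t.map (Sum.map (res (later.obj X) h) (res (later.obj Y) h))) =
      res (later.obj (freeU.star.obj (sm X Y))) h (delay X Y n t)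
  | 0, _, _, _ => rfl
  | _ + 1, 0, h, _ => absurd h (Nat.not_succ_le_zero _)
  | _ + 1, _ + 1, _, _ => rfl

theorem ap_later_id (X : ToT.{u}) (n : ℕ) (x : St (later.obj X) n) :
    ap (later.map (𝟙 X)) n x = x := by
  rw [CategoryTheory.Functor.map_id]; rfl

theorem ap_delay {X X' Y Y' : ToT.{u}} (f : X ⟶ X') (g : Y ⟶ Y') : ∀ (n : ℕ)
    (t : Term (St (later.obj X) n ⊕ St (later.obj Y) n)),
    ap (later.map (freeU.star.map (smMap f g))) n (delay X Y n t) =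
      delay X' Y' n (t.map (Sum.map (ap (later.map f) n) (ap (later.map g) n)))
  | 0, _ => rfl
  | n + 1, t => by
    refine congrArg (fun v => Term.eval Term.op v t) (funext fun x => ?_)
    rcases x with x | x <;> rfl

theorem ap_delay_right (X : ToT.{u}) {Y Y' : ToT.{u}} (g : Y ⟶ Y') (n : ℕ)
    (t : Term (St (later.obj X) n ⊕ St (later.obj Y) n)) :
    ap (later.map (freeU.star.map (smMap (𝟙 X) g))) n (delay X Y n t) =
      delay X Y' n (t.map (Sum.map id (ap (later.map g) n))) := by
  rw [ap_delay]
  have : ap (later.map (𝟙 X)) n = id := funext fun x => ap_later_id X n x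
  rw [this]

theorem ap_delay_left {X X' : ToT.{u}} (f : X ⟶ X') (Y : ToT.{u}) (n : ℕ)
    (t : Term (St (later.obj X) n ⊕ St (later.obj Y) n)) :
    ap (later.map (freeU.star.map (smMap f (𝟙 Y)))) n (delay X Y n t) =
      delay X' Y n (t.map (Sum.map (ap (later.map f) n) id)) := by
  rw [ap_delay]
  have : ap (later.map (𝟙 Y)) n = id := funext fun x => ap_later_id Y n x
  rw [this]

theorem next_res_ap {X X' : ToT.{u}} (f : X ⟶ X') {m n : ℕ} (h : m ≤ n) (x : St X n) :
    next X' m (res X' h (ap f n x)) = ap (later.map f) m (next X m (res X h x)) := by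
  rw [← ap_res, next_ap]

/-- An element of `▷_n X`, as a variable of a term over `▷_n X + ▷_n Y`. -/
abbrev vx {V W : Type u} (x : V) : Term (V ⊕ W) := Term.var (Sum.inl x)

/-- An element of `▷_n Y`, as a variable of a term over `▷_n X + ▷_n Y`. -/
abbrev vy {V W : Type u} (y : W) : Term (V ⊕ W) := Term.var (Sum.inr y)

/-- The element of `((▷ Σ⋆ (X + Y)) ^ (▷ X))_n` with components `t ↦ b_i(t)`. -/
def lam {X Y : ToT.{u}} {n : ℕ}
    (b : ∀ i, i ≤ n → St (later.obj X) i → Term (St (later.obj X) i ⊕ St (later.obj Y) i))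
    (hb : ∀ {i j : ℕ} (hij : i ≤ j) (hj : j ≤ n) (t : St (later.obj X) j),
      b i (hij.trans hj) (res (later.obj X) hij t) =
        (b j hj t).map (Sum.map (res (later.obj X) hij) (res (later.obj Y) hij))) :
    ExpSt (later.obj X) (later.obj (freeU.star.obj (sm X Y))) n where
  fn i hi t := delay X Y i (b i hi t)
  comm hij hj t := by rw [hb hij hj, delay_res]

/-- The components of the law. A premise `(p, f)` with `f = inl p'` says that `p` reduces to `p'`,
and `f = inr φ` says that `p` is a function `φ`. -/
def rhoFun (X Y : ToT.{u}) (n : ℕ) :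
    Sig (St X n × (St (later.obj Y) n ⊕ ExpSt (later.obj X) (later.obj Y) n)) →
      St (later.obj (freeU.star.obj (sm X Y))) n ⊕
        ExpSt (later.obj X) (later.obj (freeU.star.obj (sm X Y))) n
  | .S => .inr (lam (fun _ _ t => .S₁ (vx t)) (fun _ _ _ => rfl))
  | .S₁ p => .inr (lam (fun i hi t => .S₂ (vx (next X i (res X hi p.1))) (vx t))
      (fun hij hj t => by simp [Term.map, Term.eval, Term.op, ← next_res]))
  | .S₂ p q => .inr (lam (fun i hi t =>
        .app (.app (vx (next X i (res X hi p.1))) (vx t))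
          (.app (vx (next X i (res X hi q.1))) (vx t)))
      (fun hij hj t => by simp [Term.map, Term.eval, Term.op, ← next_res]))
  | .K => .inr (lam (fun _ _ t => .K₁ (vx t)) (fun _ _ _ => rfl))
  | .K₁ p => .inr (lam (fun i hi _ => vx (next X i (res X hi p.1)))
      (fun hij hj t => by simp [Term.map, Term.eval, ← next_res]))
  | .I => .inr (lam (fun _ _ t => vx t) (fun _ _ _ => rfl))
  | .app (_, .inl p') (q, _) => .inl (delay X Y n (.app (vy p') (vx (next X n q))))
  | .app (_, .inr φ) (q, _) => .inl (delay X Y n (vy (φ.fn n (le_refl n) (next X n q))))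

theorem expSt_ext {X Y : ToT.{u}} {n : ℕ} {φ ψ : ExpSt X Y n}
    (h : ∀ i hi x, φ.fn i hi x = ψ.fn i hi x) : φ = ψ :=
  ExpSt.ext (funext fun i => funext fun hi => funext fun x => h i hi x)

/-- The higher-order GSOS law of xCL. -/
def rhoU : HOGSOSLaw Su.{u} freeU Bu where
  rho X Y := mkHom (X := Su.obj (prd X ((Bu.obj (op X)).obj Y)))
    (Y := (Bu.obj (op X)).obj (freeU.star.obj (sm X Y))) (rhoFun X Y)
    (fun {m n} h s => by
      rcases s with _ | _ | _ | ⟨p, f⟩ | ⟨p, f⟩ | ⟨⟨p, f⟩, ⟨q, g⟩⟩ | ⟨⟨p, f | f⟩, ⟨q, g⟩⟩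
      · rfl
      · rfl
      · rfl
      · refine congrArg Sum.inr (expSt_ext fun i hi x => ?_)
        change delay X Y i (.S₂ (vx (next X i (res X hi (res X h p)))) (vx x)) = _
        rw [res_res]; rfl
      · refine congrArg Sum.inr (expSt_ext fun i hi x => ?_)
        change delay X Y i (vx (next X i (res X hi (res X h p)))) = _
        rw [res_res]; rfl
      · refine congrArg Sum.inr (expSt_ext fun i hi x => ?_)
        change delay X Y i (.app (.app (vx (next X i (res X hi (res X h p)))) (vx x))
          (.app (vx (next X i (res X hi (res X h q)))) (vx x))) = _
        rw [res_res, res_res]; rfl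
      · refine congrArg Sum.inl ?_
        refine Eq.trans ?_ (delay_res X Y h _)
        change delay X Y m (.app (vy (res (later.obj Y) h f)) (vx (next X m (res X h q)))) = _
        rw [next_res]; rfl
      · refine congrArg Sum.inl ?_
        refine Eq.trans ?_ (delay_res X Y h _)
        change delay X Y m (vy (ExpSt.fn f m _ (next X m (res X h q)))) = _
        rw [next_res, ExpSt.comm f h (le_refl n)]; rfl)
  natural X {Y Y'} g := hom_ext fun n s => by
    rcases s with _ | _ | _ | ⟨p, f⟩ | ⟨p, f⟩ | ⟨⟨p, f⟩, ⟨q, h⟩⟩ | ⟨⟨p, f | f⟩, ⟨q, h⟩⟩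
    · exact congrArg Sum.inr (expSt_ext fun i hi x => Eq.trans (by rfl) (ap_delay_right X g i _).symm)
    · exact congrArg Sum.inr (expSt_ext fun i hi x => Eq.trans (by rfl) (ap_delay_right X g i _).symm)
    · exact congrArg Sum.inr (expSt_ext fun i hi x => Eq.trans (by rfl) (ap_delay_right X g i _).symm)
    · exact congrArg Sum.inr (expSt_ext fun i hi x => Eq.trans (by rfl) (ap_delay_right X g i _).symm)
    · exact congrArg Sum.inr (expSt_ext fun i hi x => Eq.trans (by rfl) (ap_delay_right X g i _).symm)
    · exact congrArg Sum.inr (expSt_ext fun i hi x => Eq.trans (by rfl) (ap_delay_right X g i _).symm)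
    · exact congrArg Sum.inl (Eq.trans (by rfl) (ap_delay_right X g n _).symm)
    · exact congrArg Sum.inl (Eq.trans (by rfl) (ap_delay_right X g n _).symm)
  dinatural {X X'} f Y := hom_ext fun n s => by
    rcases s with _ | _ | _ | ⟨p, c⟩ | ⟨p, c⟩ | ⟨⟨p, c⟩, ⟨q, d⟩⟩ | ⟨⟨p, c | c⟩, ⟨q, d⟩⟩
    · exact congrArg Sum.inr (expSt_ext fun i hi x => Eq.trans (by rfl) (ap_delay_left f Y i _).symm)
    · exact congrArg Sum.inr (expSt_ext fun i hi x => Eq.trans (by rfl) (ap_delay_left f Y i _).symm)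
    · exact congrArg Sum.inr (expSt_ext fun i hi x => Eq.trans (by rfl) (ap_delay_left f Y i _).symm)
    · refine congrArg Sum.inr (expSt_ext fun i hi x => Eq.trans ?_ (ap_delay_left f Y i _).symm)
      change delay X' Y i (.S₂ (vx (next X' i (res X' hi (ap f n p))))
        (vx (ap (later.map f) i x))) = _
      rw [next_res_ap]; rfl
    · refine congrArg Sum.inr (expSt_ext fun i hi x => Eq.trans ?_ (ap_delay_left f Y i _).symm)
      change delay X' Y i (vx (next X' i (res X' hi (ap f n p)))) = _
      rw [next_res_ap]; rfl
    · refine congrArg Sum.inr (expSt_ext fun i hi x => Eq.trans ?_ (ap_delay_left f Y i _).symm)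
      change delay X' Y i (.app
        (.app (vx (next X' i (res X' hi (ap f n p)))) (vx (ap (later.map f) i x)))
        (.app (vx (next X' i (res X' hi (ap f n q)))) (vx (ap (later.map f) i x)))) = _
      rw [next_res_ap, next_res_ap]; rfl
    · refine congrArg Sum.inl (Eq.trans ?_ (ap_delay_left f Y n _).symm)
      change delay X' Y n (.app (vy c) (vx (next X' n (ap f n q)))) = _
      rw [next_ap]; rfl
    · refine congrArg Sum.inl (Eq.trans ?_ (ap_delay_left f Y n _).symm)
      change delay X' Y n (vy (ExpSt.fn c n _ (next X' n (ap f n q)))) = _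
      rw [next_ap]; rfl

/-! ### The operational model -/

/-- Primitive recursion over programs. -/
def Term.para {A : Type u} (r : Sig (Prog.{u} × A) → A) : Prog.{u} → A
  | var x => x.elim
  | S => r .S
  | K => r .K
  | I => r .I
  | S₁ p => r (.S₁ (p, p.para r))
  | K₁ p => r (.K₁ (p, p.para r))
  | S₂ p q => r (.S₂ (p, p.para r) (q, q.para r))
  | app p q => r (.app (p, p.para r) (q, q.para r))

theorem Term.para_op {A : Type u} (r : Sig (Prog.{u} × A) → A) (t : Sig Prog.{u}) :
    (Term.op t).para r = r (t.map (fun p => (p, p.para r))) := by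
  cases t <;> rfl

theorem Term.para_unique {A : Type u} (r : Sig (Prog.{u} × A) → A) (k : Prog.{u} → A)
    (hk : ∀ t, k (Term.op t) = r (t.map (fun p => (p, k p)))) (p : Prog.{u}) : k p = p.para r := by
  induction p with
  | var x => exact x.elim
  | S => exact hk .S
  | K => exact hk .K
  | I => exact hk .I
  | S₁ p ihp => rw [para, ← ihp]; exact hk (.S₁ p)
  | K₁ p ihp => rw [para, ← ihp]; exact hk (.K₁ p)
  | S₂ p q ihp ihq => rw [para, ← ihp, ← ihq]; exact hk (.S₂ p q)
  | app p q ihp ihq => rw [para, ← ihp, ← ihq]; exact hk (.app p q)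

/-- The object `B(μΣ, μΣ)`. -/
abbrev BMu : ToT.{u} := (Bu.obj (op Mu)).obj Mu

/-- The recursion step `B(id, ι̂ · Σ⋆ ∇) · ρ : Σ (μΣ × B(μΣ, μΣ)) ⟶ B(μΣ, μΣ)`. -/
def gammaStep : Su.obj (prd Mu BMu.{u}) ⟶ BMu :=
  rhoU.rho Mu Mu ≫ (Bu.obj (op Mu)).map (freeU.star.map (codiag Mu) ≫ freeU.hat muAlg)

theorem gamma_nat {m n : ℕ} (h : m ≤ n) (p : Prog.{u}) :
    res BMu h (p.para (ap gammaStep n)) = p.para (ap gammaStep m) := by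
  refine Term.para_unique (ap gammaStep m) (fun p => res BMu h (p.para (ap gammaStep n)))
    (fun t => ?_) p
  refine (congrArg (res BMu h) (Term.para_op (ap gammaStep n) t)).trans ?_
  refine (ap_res gammaStep h _).symm.trans (congrArg (ap gammaStep m) ?_)
  cases t <;> rfl

/-- The operational model `γ : μΣ ⟶ B(μΣ, μΣ)` of the law, defined by primitive recursion. -/
def gamma : Mu.{u} ⟶ BMu :=
  mkHom (X := Mu) (Y := BMu) (fun n p => Term.para (ap gammaStep n) p)
    (fun h p => (gamma_nat h p).symm)

/-- `γ` makes the defining diagram of the operational model commute. -/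
theorem gamma_isBialgebra : IsBialgebra rhoU Mu.{u} muAlg.str gamma :=
  hom_ext fun n t => by
    refine (Term.para_op (ap gammaStep n) t).trans ?_
    cases t <;> rfl

/-- `γ` is the only morphism with this property. -/
theorem gamma_unique (c : Mu.{u} ⟶ BMu) (hc : IsBialgebra rhoU Mu.{u} muAlg.str c) : c = gamma :=
  hom_ext fun n p => by
    refine Term.para_unique (ap gammaStep n) (ap c n) (fun t => ?_) p
    have h : ap (muAlg.str ≫ c) n t = _ := congrArg (fun k => ap k n t) hc
    refine h.trans (congrArg (ap gammaStep n) ?_)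
    cases t <;> rfl

/-- The operational model as a coalgebra for `B(μΣ, -)`. -/
def opModel : Endofunctor.Coalgebra (Bu.obj (op Mu.{u})) := ⟨Mu, gamma⟩

/-- The map `beh : μΣ ⟶ ν B(μΣ, -)` into a final `B(μΣ, -)`-coalgebra. -/
def beh (N : Endofunctor.Coalgebra (Bu.obj (op Mu.{u}))) (hN : Limits.IsTerminal N) : Mu ⟶ N.V :=
  (hN.from opModel).f

/-- A `Σ`-algebra is adequate if `beh` factorizes through `⟦-⟧`. -/
def IsAdequate (A : Endofunctor.Algebra Su.{u}) : Prop :=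
  ∀ (N : Endofunctor.Coalgebra (Bu.obj (op Mu.{u}))) (hN : Limits.IsTerminal N),
    ∃ h : A.a ⟶ N.V, den A ≫ h = beh N hN

/-! ### Operational rules and step-indexed strong applicative bisimilarity -/

/-- Labelled transitions: `Lab p t p'` means that `p` maps the input `t` to `p'`. -/
inductive Lab : Prog.{u} → Prog.{u} → Prog.{u} → Prop
  | S (t : Prog) : Lab .S t (.S₁ t)
  | S₁ (p t : Prog) : Lab (.S₁ p) t (.S₂ p t)
  | S₂ (p q t : Prog) : Lab (.S₂ p q) t (.app (.app p t) (.app q t))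
  | K (t : Prog) : Lab .K t (.K₁ t)
  | K₁ (p t : Prog) : Lab (.K₁ p) t p
  | I (t : Prog) : Lab .I t t

/-- Unlabelled transitions (reductions). -/
inductive Red : Prog.{u} → Prog.{u} → Prop
  | left {p p' : Prog} (q : Prog) : Red p p' → Red (.app p q) (.app p' q)
  | beta {p q p' : Prog} : Lab p q p' → Red (.app p q) p'

/-- The conditions on an `ω`-indexed family of equivalence relations on programs of which
step-indexed strong applicative bisimilarity is the greatest solution. -/
structure IsStepBisim (R : ℕ → Prog.{u} → Prog.{u} → Prop) : Prop where
  equiv : ∀ n, Equivalence (R n)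
  mono : ∀ n p q, R (n + 1) p q → R n p q
  red : ∀ n p q p', R (n + 1) p q → Red p p' → ∃ q', Red q q' ∧ R n p' q'
  lab : ∀ n p q t p', R (n + 1) p q → Lab p t p' → ∃ q', Lab q t q' ∧ R n p' q'

/-- Step-indexed strong applicative bisimilarity `p ∼_n q`. -/
def StepBisim (n : ℕ) (p q : Prog.{u}) : Prop :=
  ∃ R : ℕ → Prog.{u} → Prog.{u} → Prop, IsStepBisim R ∧ R n p q

/-- The transition conditions for one step. -/
def OneStep (R : Prog.{u} → Prog.{u} → Prop) (p q : Prog.{u}) : Prop :=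
  (∀ p', Red p p' → ∃ q', Red q q' ∧ R p' q') ∧
    (∀ t p', Lab p t p' → ∃ q', Lab q t q' ∧ R p' q')

theorem OneStep.trans {R : Prog.{u} → Prog.{u} → Prop} (hR : Equivalence R) {p q s : Prog.{u}}
    (h : OneStep R p q) (h' : OneStep R q s) : OneStep R p s := by
  refine ⟨fun p' hp => ?_, fun t p' hp => ?_⟩
  · obtain ⟨q', hq, hr⟩ := h.1 p' hp
    obtain ⟨s', hs, hr'⟩ := h'.1 q' hq
    exact ⟨s', hs, hR.trans hr hr'⟩
  · obtain ⟨q', hq, hr⟩ := h.2 t p' hp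
    obtain ⟨s', hs, hr'⟩ := h'.2 t q' hq
    exact ⟨s', hs, hR.trans hr hr'⟩

/-- The iterative description of step-indexed strong applicative bisimilarity. -/
def StepRel : ℕ → Prog.{u} → Prog.{u} → Prop
  | 0, _, _ => True
  | n + 1, p, q => StepRel n p q ∧ OneStep (StepRel n) p q ∧ OneStep (StepRel n) q p

theorem stepRel_isStepBisim : IsStepBisim StepRel.{u} where
  equiv n := by
    induction n with
    | zero => exact ⟨fun _ => trivial, fun _ => trivial, fun _ _ => trivial⟩
    | succ n ih =>
      have hrefl : ∀ p, OneStep (StepRel n) p p := fun p =>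
        ⟨fun p' h => ⟨p', h, ih.refl p'⟩, fun t p' h => ⟨p', h, ih.refl p'⟩⟩
      exact ⟨fun p => ⟨ih.refl p, hrefl p, hrefl p⟩, fun h => ⟨ih.symm h.1, h.2.2, h.2.1⟩,
        fun h h' => ⟨ih.trans h.1 h'.1, h.2.1.trans ih h'.2.1, h'.2.2.trans ih h.2.2⟩⟩
  mono _ _ _ h := h.1
  red _ _ _ p' h := h.2.1.1 p'
  lab _ _ _ t p' h := h.2.1.2 t p'

theorem IsStepBisim.le_stepRel {R : ℕ → Prog.{u} → Prog.{u} → Prop} (hR : IsStepBisim R) (n : ℕ) :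
    ∀ p q, R n p q → StepRel n p q := by
  induction n with
  | zero => exact fun _ _ _ => trivial
  | succ n ih =>
    have step : ∀ p q, R (n + 1) p q → OneStep (StepRel n) p q := fun p q h =>
      ⟨fun p' hp => (hR.red n p q p' h hp).imp fun q' hq => ⟨hq.1, ih _ _ hq.2⟩,
        fun t p' hp => (hR.lab n p q t p' h hp).imp fun q' hq => ⟨hq.1, ih _ _ hq.2⟩⟩
    exact fun p q h =>
      ⟨ih p q (hR.mono n p q h), step p q h, step q p ((hR.equiv (n + 1)).symm h)⟩

/-- `StepBisim` is the greatest family satisfying `IsStepBisim`. -/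
theorem stepBisim_isGreatest : IsGreatest {R | IsStepBisim.{u} R} StepBisim := by
  have h : StepBisim.{u} = StepRel := by
    funext n p q
    exact propext ⟨fun ⟨R, hR, h⟩ => hR.le_stepRel n p q h, fun h => ⟨_, stepRel_isStepBisim, h⟩⟩
  refine ⟨?_, fun R hR n p q hpq => ⟨R, hR, hpq⟩⟩
  rw [h]
  exact stepRel_isStepBisim

/-! ### Guarded interaction trees -/

/-- Data for the recursive definition of guarded interaction trees at a stage `n`:
`tree` is the set `Z_n` of trees, `fns` the set of tuples `(f_0 : Z_0 → Z_0, …, f_n : Z_n → Z_n)`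
of maps commuting with restrictions, `last` is `(f_0, …, f_n) ↦ f_n`, and `down` is the restriction
map `Z_{n+1} = Z_n + fns → Z_n`. -/
structure GITStage : Type (u + 1) where
  tree : Type u
  fns : Type u
  last : fns → tree → tree
  down : tree ⊕ fns → tree

/-- Stage `0`: `Z_0 = 1 + 1`. -/
def GITStage.zero : GITStage.{u} where
  tree := PUnit.{u + 1} ⊕ PUnit.{u + 1}
  fns := PUnit.{u + 1} ⊕ PUnit.{u + 1} → PUnit.{u + 1} ⊕ PUnit.{u + 1}
  last := fun f => f
  down := Sum.map (fun _ => PUnit.unit) (fun _ => PUnit.unit)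

/-- Stage `n + 1` from stage `n`: an element of `Z_{n+1}` is either a tree at stage `n` or a tuple
`(f_0, …, f_n)`, and a tuple `(f_0, …, f_{n+1})` consists of a tuple `(f_0, …, f_n)` and a
compatible map `f_{n+1} : Z_{n+1} → Z_{n+1}`. -/
def GITStage.succ (s : GITStage.{u}) : GITStage.{u} where
  tree := s.tree ⊕ s.fns
  fns := {e : s.fns × (s.tree ⊕ s.fns → s.tree ⊕ s.fns) //
    ∀ x, s.down (e.2 x) = s.last e.1 (s.down x)}
  last := fun e => e.1.2
  down := Sum.map s.down (fun e => e.1.1)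

/-- The stages of the guarded interaction trees. -/
def gitStage : ℕ → GITStage.{u}
  | 0 => GITStage.zero
  | n + 1 => (gitStage n).succ

/-- The restriction map `Z_{n+1} → Z_n`. -/
def gitDown (n : ℕ) : (gitStage.{u} (n + 1)).tree → (gitStage.{u} n).tree := (gitStage n).down

/-- Truncation `(f_0, …, f_{n+1}) ↦ (f_0, …, f_n)` of tuples. -/
def gitTrunc (n : ℕ) (e : (gitStage.{u} (n + 1)).fns) : (gitStage.{u} n).fns :=
  (show (gitStage.{u} n).succ.fns from e).1.1

theorem gitDown_last (n : ℕ) (e : (gitStage.{u} (n + 1)).fns) (x : (gitStage.{u} (n + 1)).tree) :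
    gitDown n ((gitStage (n + 1)).last e x) = (gitStage n).last (gitTrunc n e) (gitDown n x) :=
  (show (gitStage.{u} n).succ.fns from e).2 x

/-- The presheaf of guarded interaction trees. -/
def GIT : ToT.{u} :=
  CategoryTheory.Functor.ofOpSequence (X := fun n => (gitStage.{u} n).tree) (fun n => ↾(gitDown n))

/-- The presheaf of tuples `(f_0, …, f_n)`, restriction being truncation. -/
def GITFns : ToT.{u} :=
  CategoryTheory.Functor.ofOpSequence (X := fun n => (gitStage.{u} n).fns) (fun n => ↾(gitTrunc n))

theorem git_res_succ (n : ℕ) (x : St GIT.{u} (n + 1)) :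
    res GIT (Nat.le_succ n) x = gitDown n x := by
  have h := CategoryTheory.Functor.ofOpSequence_map_homOfLE_succ
    (X := fun n => (gitStage.{u} n).tree) (fun n => ↾(gitDown.{u} n)) n
  exact congrArg (fun k : (gitStage.{u} (n + 1)).tree ⟶ (gitStage.{u} n).tree => k x) h

theorem gitFns_res_succ (n : ℕ) (e : St GITFns.{u} (n + 1)) :
    res GITFns (Nat.le_succ n) e = gitTrunc n e := by
  have h := CategoryTheory.Functor.ofOpSequence_map_homOfLE_succ
    (X := fun n => (gitStage.{u} n).fns) (fun n => ↾(gitTrunc.{u} n)) n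
  exact congrArg (fun k : (gitStage.{u} (n + 1)).fns ⟶ (gitStage.{u} n).fns => k e) h

/-- The map `f_i` of a tuple `e = (f_0, …, f_n)`. -/
def gitFn {n : ℕ} (e : St GITFns.{u} n) (i : ℕ) (hi : i ≤ n) : St GIT.{u} i → St GIT i :=
  (gitStage i).last (res GITFns hi e)

theorem gitFn_comm {n : ℕ} (e : St GITFns.{u} n) {i j : ℕ} (hij : i ≤ j) (hj : j ≤ n)
    (x : St GIT.{u} j) :
    gitFn e i (hij.trans hj) (res GIT hij x) = res GIT hij (gitFn e j hj x) := by
  induction j, hij using Nat.le_induction with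
  | base => simp
  | succ j hij ih =>
    have h : gitFn e j ((Nat.le_succ j).trans hj) (res GIT (Nat.le_succ j) x) =
        res GIT (Nat.le_succ j) (gitFn e (j + 1) hj x) := by
      rw [git_res_succ, git_res_succ]
      refine Eq.trans ?_ (gitDown_last j (res GITFns hj e) x).symm
      refine congrArg (fun d => (gitStage j).last d (gitDown j x)) ?_
      rw [← res_res GITFns (Nat.le_succ j) hj]
      exact gitFns_res_succ j _
    rw [← res_res GIT hij (Nat.le_succ j), ← res_res GIT hij (Nat.le_succ j), ← h]
    exact ih _ _

/-- A tuple `(f_0, …, f_n)` as an element of `((▷ Z) ^ (▷ Z))_{n+1}`. -/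
def gitExp {n : ℕ} (e : St GITFns.{u} n) : ExpSt (later.obj GIT.{u}) (later.obj GIT) (n + 1) where
  fn
    | 0, _ => fun x => x
    | i + 1, hi => gitFn e i (Nat.le_of_succ_le_succ hi)
  comm {i j} hij hj x :=
    match i, j, hij, hj, x with
    | 0, _, _, _, _ => rfl
    | _ + 1, _ + 1, hij, hj, x =>
      gitFn_comm e (Nat.le_of_succ_le_succ hij) (Nat.le_of_succ_le_succ hj) x

/-- The unique element of `((▷ Z) ^ (▷ Z))_0 = 1 ^ 1`. -/
def gitExpZero : ExpSt (later.obj GIT.{u}) (later.obj GIT) 0 where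
  fn _ _ x := x
  comm _ _ _ := rfl

/-- The components of the coalgebra structure on guarded interaction trees. -/
def gitStr : ∀ n, (gitStage.{u} n).tree →
    LaterSt GIT.{u} n ⊕ ExpSt (later.obj GIT.{u}) (later.obj GIT) n
  | 0 => Sum.map (fun x => x) (fun _ => gitExpZero)
  | n + 1 => Sum.map (fun z => z) (fun e => gitExp (n := n) e)

theorem gitStr_succ : ∀ (n : ℕ) (x : St GIT.{u} (n + 1)),
    gitStr n (res GIT (Nat.le_succ n) x) =
      res ((Bu.obj (op GIT)).obj GIT) (Nat.le_succ n) (gitStr (n + 1) x) := by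
  intro n x
  rw [git_res_succ]
  obtain _ | n := n
  · obtain z | e := (show (gitStage 0).tree ⊕ (gitStage 0).fns from x)
    · rfl
    · refine congrArg Sum.inr (expSt_ext fun i hi y => ?_)
      obtain rfl := Nat.le_zero.mp hi
      rfl
  · obtain z | e := (show (gitStage (n + 1)).tree ⊕ (gitStage (n + 1)).fns from x)
    · exact congrArg Sum.inl (git_res_succ n z).symm
    · refine congrArg Sum.inr (expSt_ext fun i hi y => ?_)
      obtain _ | i := i
      · rfl
      · change (gitStage i).last (res GITFns (Nat.le_of_succ_le_succ hi) (gitTrunc n e)) y =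
          (gitStage i).last (res GITFns (n := n + 1) ((Nat.le_succ i).trans hi) e) y
        refine congrArg (fun d => (gitStage i).last d y) ?_
        exact (congrArg (res GITFns (Nat.le_of_succ_le_succ hi)) (gitFns_res_succ n e).symm).trans
          (res_res GITFns _ _ _)

/-- The higher-order coalgebra `Z ⟶ B(Z, Z)` of guarded interaction trees: at stage `0` it is
`1 + 1 ≅ 1 + 1 ^ 1`, and at stage `n + 1` it sends a tree `z` at stage `n` to `z` and a tuple
`(f_0, …, f_n)` to itself. -/
def git : GIT.{u} ⟶ (Bu.obj (op GIT)).obj GIT :=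
  mkHom (X := GIT) (Y := (Bu.obj (op GIT)).obj GIT) gitStr (fun {m n} h x => by
    induction n, h using Nat.le_induction with
    | base =>
      rw [res_refl]
      exact (res_refl ((Bu.obj (op GIT)).obj GIT) _ _).symm
    | succ n h ih =>
      rw [← res_res GIT h (Nat.le_succ n), ih, gitStr_succ]
      exact res_res ((Bu.obj (op GIT)).obj GIT) h (Nat.le_succ n) _)

end XCL

open XCL

/-!
The functors `B(X, -)` are locally contractive: `B(X, f)` at stage `n` only involves the components
of `f` below `n`, which is witnessed by `strength`, an action of *delayed* tuples of maps on
behaviours. Everything rests on the resulting guarded corecursion principle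
`exists_guarded_corec`: if `c : C ≅ B(X, C)`, then an equation `f ≫ c = d ≫ B(X, θ f)` can be solved
for `f`, whatever the operation `θ` on internal homs, by taking a guarded fixed point of a map
`▷ (C ^ D) ⟶ C ^ D`.

With `θ` the identity, the principle yields that every coalgebra for `B(X, -)` with invertible
structure is final (`isTerminal_of_isIso`); this applies to the guarded interaction trees
(`gitStr_bijective`) and to an explicit presheaf of trees branching over programs (`nuCoalg`), which
is the final coalgebra for `B(μΣ, -)`. With `θ` the evaluation of terms, it yields the algebra
structure that turns a locally final coalgebra, whose structure is invertible by Lambek's lemma,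
into a bialgebra (`exists_isBialgebra`).

For adequacy, the algebra morphism from `μΣ` to a bialgebra `Z` is a coalgebra morphism for
`B(μΣ, -)` when the inputs of `Z` are restricted along it (`den_coalgebra`); hence `beh` factorizes
through `Z`. Finally, the operational model is a delayed version of the deterministic transition
function of xCL (`gamma_eq_step`), and both behavioural equivalence and step-indexed bisimilarity
unfold along this function in the same manner. Soundness of the denotational model for bisimilarity
follows from adequacy.
-/

namespace XCL

/-! ### Guarded recursion -/

/-- A morphism `f`, as the tuple of its first `n + 1` components. -/
def tuple {X Y : ToT.{u}} (f : X ⟶ Y) (n : ℕ) : St (expObj X Y) n :=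
  ⟨fun i _ x => ap f i x, fun hij _ x => ap_res f hij x⟩

/-- The guarded fixed point of `φ : ▷ A ⟶ A`, a global element of `A`. -/
def gfix {A : ToT.{u}} (φ : later.obj A ⟶ A) : ∀ n, St A n
  | 0 => ap φ 0 PUnit.unit
  | n + 1 => ap φ (n + 1) (gfix φ n)

theorem res_gfix_succ {A : ToT.{u}} (φ : later.obj A ⟶ A) :
    ∀ n, res A (Nat.le_succ n) (gfix φ (n + 1)) = gfix φ n
  | 0 => (ap_res φ (Nat.le_succ 0) _).symm
  | n + 1 => (ap_res φ (Nat.le_succ (n + 1)) _).symm.trans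
      (congrArg (ap φ (n + 1)) (res_gfix_succ φ n))

theorem res_gfix {A : ToT.{u}} (φ : later.obj A ⟶ A) {m n : ℕ} (h : m ≤ n) :
    res A h (gfix φ n) = gfix φ m := by
  induction n, h using Nat.le_induction with
  | base => exact res_refl A _ _
  | succ n h ih => rw [← res_res A h (Nat.le_succ n), res_gfix_succ, ih]

theorem gfix_eq {A : ToT.{u}} (φ : later.obj A ⟶ A) :
    ∀ n, gfix φ n = ap φ n (next A n (gfix φ n))
  | 0 => rfl
  | n + 1 => (congrArg (ap φ (n + 1)) (res_gfix_succ φ n)).symm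

/-- Delayed application `▷ (Y ^ X) × ▷ X ⟶ ▷ Y`. -/
def lapp {X Y : ToT.{u}} : ∀ n, St (later.obj (expObj X Y)) n → St (later.obj X) n →
    St (later.obj Y) n
  | 0, _, _ => PUnit.unit
  | n + 1, e, x => ExpSt.fn (X := X) (Y := Y) (n := n) e n le_rfl x

theorem lapp_res {X Y : ToT.{u}} : ∀ {m n : ℕ} (h : m ≤ n) (e : St (later.obj (expObj X Y)) n)
    (x : St (later.obj X) n),
    lapp m (res _ h e) (res _ h x) = res (later.obj Y) h (lapp n e x)
  | 0, _, _, _, _ => rfl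
  | _ + 1, 0, h, _, _ => absurd h (Nat.not_succ_le_zero _)
  | _ + 1, _ + 1, h, e, x =>
    ExpSt.comm (X := X) (Y := Y) e (Nat.le_of_succ_le_succ h) le_rfl x

theorem lapp_tuple {X Y : ToT.{u}} (f : X ⟶ Y) : ∀ (n : ℕ) (x : St (later.obj X) n),
    lapp n (next _ n (tuple f n)) x = ap (later.map f) n x
  | 0, _ => rfl
  | _ + 1, _ => rfl

/-- The strength `▷ (Y ^ W) × B(X, W) ⟶ B(X, Y)`. That it is defined on *delayed* tuples of maps
expresses that `B(X, -)` is locally contractive. -/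
def strength (X : ToT.{u}) {W Y : ToT.{u}} (n : ℕ) (e : St (later.obj (expObj W Y)) n) :
    St ((Bu.obj (op X)).obj W) n → St ((Bu.obj (op X)).obj Y) n :=
  Sum.map (lapp n e) fun φ =>
    ⟨fun i hi y => lapp i (res _ hi e) (ExpSt.fn φ i hi y), fun {i j} hij hj y => by
      rw [ExpSt.comm φ hij hj, ← lapp_res, res_res]⟩

theorem strength_res (X : ToT.{u}) {W Y : ToT.{u}} {m n : ℕ} (h : m ≤ n)
    (e : St (later.obj (expObj W Y)) n) (b : St ((Bu.obj (op X)).obj W) n) :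
    strength X m (res _ h e) (res _ h b) = res ((Bu.obj (op X)).obj Y) h (strength X n e b) := by
  rcases b with b | b
  · exact congrArg Sum.inl (lapp_res h e b)
  · refine congrArg Sum.inr (expSt_ext fun i hi y => ?_)
    exact congrArg (fun d => lapp i d _) (res_res _ hi h e)

theorem strength_tuple (X : ToT.{u}) {W Y : ToT.{u}} (g : W ⟶ Y) (n : ℕ)
    (b : St ((Bu.obj (op X)).obj W) n) :
    strength X n (next _ n (tuple g n)) b = ap ((Bu.obj (op X)).map g) n b := by
  rcases b with b | b
  · exact congrArg Sum.inl (lapp_tuple g n b)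
  · refine congrArg Sum.inr (expSt_ext fun i hi y => ?_)
    refine Eq.trans ?_ (lapp_tuple g i _)
    exact congrArg (fun d => lapp i d _) (next_res _ hi (tuple g n)).symm

/-- Guarded corecursion: if `c : C ≅ B(X, C)`, then `f ≫ c = d ≫ B(X, θ f)` has a solution `f`, for
every operation `θ` turning maps `D ⟶ C` into maps `W ⟶ C`. -/
theorem exists_guarded_corec {X C D W : ToT.{u}} (c : C ⟶ (Bu.obj (op X)).obj C) [IsIso c]
    (d : D ⟶ (Bu.obj (op X)).obj W) (θ : expObj D C ⟶ expObj W C) :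
    ∃ f : D ⟶ C, ∀ g : W ⟶ C, (∀ n, ap θ n (tuple f n) = tuple g n) →
      f ≫ c = d ≫ (Bu.obj (op X)).map g := by
  -- `Φ e = d ≫ B(X, θ e) ≫ c⁻¹`, internally: by `strength` the right side makes sense for delayed `e`.
  let Φ : later.obj (expObj D C) ⟶ expObj D C :=
    mkHom (X := later.obj (expObj D C)) (Y := expObj D C)
      (fun n e => ⟨fun i hi x =>
          ap (inv c) i (strength X i (ap (later.map θ) i (res _ hi e)) (ap d i x)),
        fun {i j} hij hj x => by
          rw [ap_res d hij x, ← ap_res (inv c) hij, ← strength_res,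
            ← ap_res (later.map θ), res_res]⟩)
      (fun {m n} h e => expSt_ext fun i hi x =>
        congrArg (fun e' => ap (inv c) i (strength X i (ap (later.map θ) i e') (ap d i x)))
          (res_res _ hi h e))
  let f : D ⟶ C := mkHom (fun n x => ExpSt.fn (gfix Φ n) n le_rfl x) fun {m n} h x => by
    refine Eq.trans ?_ (ExpSt.comm (gfix Φ n) h le_rfl x)
    rw [← res_gfix Φ h]
    rfl
  have hf : ∀ n, tuple f n = gfix Φ n := fun n => expSt_ext fun i hi x => by
    change ExpSt.fn (gfix Φ i) i le_rfl x = _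
    rw [← res_gfix Φ hi]
    rfl
  refine ⟨f, fun g hg => ?_⟩
  have key : f = (d ≫ (Bu.obj (op X)).map g) ≫ inv c := hom_ext fun n x => by
    change ExpSt.fn (gfix Φ n) n le_rfl x = ap (inv c) n (ap ((Bu.obj (op X)).map g) n (ap d n x))
    rw [gfix_eq]
    change ap (inv c) n (strength X n (ap (later.map θ) n (res _ le_rfl (next _ n (gfix Φ n))))
      (ap d n x)) = _
    rw [res_refl, ← next_ap, ← hf, hg, strength_tuple]
  rw [key, Category.assoc, IsIso.inv_hom_id, Category.comp_id]

/-- The action of `B(X, -)` on morphisms depends, at each stage, only on the earlier stages. -/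
theorem ap_Bu_map_congr {X D C : ToT.{u}} {f g : D ⟶ C} : ∀ {n : ℕ},
    (∀ m < n, ∀ x, ap f m x = ap g m x) → ∀ b : St ((Bu.obj (op X)).obj D) n,
    ap ((Bu.obj (op X)).map f) n b = ap ((Bu.obj (op X)).map g) n b := by
  intro n h b
  have h' : ∀ i ≤ n, ∀ x, ap (later.map f) i x = ap (later.map g) i x := by
    rintro (_ | i) hi x
    · rfl
    · exact h i hi x
  rcases b with b | b
  · exact congrArg Sum.inl (h' n le_rfl b)
  · exact congrArg Sum.inr (expSt_ext fun i hi y => h' i hi _)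

/-- A coalgebra for `B(X, -)` whose structure is an isomorphism is final. -/
theorem isTerminal_of_isIso {X C : ToT.{u}} (c : C ⟶ (Bu.obj (op X)).obj C) [IsIso c] :
    Nonempty (Limits.IsTerminal (⟨C, c⟩ : Endofunctor.Coalgebra (Bu.obj (op X)))) := by
  have hex : ∀ D : Endofunctor.Coalgebra (Bu.obj (op X)),
      ∃ f : D.V ⟶ C, f ≫ c = D.str ≫ (Bu.obj (op X)).map f := fun D =>
    (exists_guarded_corec c D.str (𝟙 _)).imp fun f hf => hf f fun _ => rfl
  choose f hf using hex
  refine ⟨Limits.IsTerminal.ofUniqueHom (fun D => ⟨f D, (hf D).symm⟩) fun D k => ?_⟩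
  ext : 1
  refine hom_ext fun n => ?_
  change ∀ x, ap k.f n x = ap (f D) n x
  induction n using Nat.strong_induction_on with
  | _ n ih =>
    intro x
    have hk : k.f ≫ c = D.str ≫ (Bu.obj (op X)).map k.f := k.h.symm
    have key : ap (k.f ≫ c) n x = ap (f D ≫ c) n x := by
      rw [hk, hf]
      exact ap_Bu_map_congr ih _
    have := congrArg (ap (inv c) n) key
    simpa only [← ap_comp, Category.assoc, IsIso.hom_inv_id, Category.comp_id] using this

theorem isIso_of_bijective {X Y : ToT.{u}} (f : X ⟶ Y)
    (h : ∀ n, Function.Bijective (ap f n)) : IsIso f := by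
  have : ∀ n, IsIso (f.app n) := fun n => (isIso_iff_bijective _).2 (h n.unop)
  exact NatIso.isIso_of_isIso_app f

/-! ### Guarded interaction trees are locally final -/

theorem gitFn_self {n : ℕ} (e : St GITFns.{u} n) : gitFn e n le_rfl = (gitStage n).last e :=
  congrArg (gitStage n).last (res_refl GITFns le_rfl e)

theorem gitFn_gitTrunc {n : ℕ} (e : St GITFns.{u} (n + 1)) (i : ℕ) (hi : i ≤ n) :
    gitFn (n := n) (gitTrunc n e) i hi = gitFn e i (hi.trans (Nat.le_succ n)) := by
  refine congrArg (gitStage i).last ?_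
  rw [← gitFns_res_succ]
  exact res_res GITFns hi (Nat.le_succ n) e

/-- A tuple `(f_0, …, f_n)` is determined by its components. -/
theorem gitFn_injective : ∀ {n : ℕ} {e e' : St GITFns.{u} n},
    (∀ i hi, gitFn e i hi = gitFn e' i hi) → e = e'
  | 0, e, e', h => by
    have := h 0 le_rfl
    rwa [gitFn_self, gitFn_self] at this
  | n + 1, e, e', h => by
    have h₁ : gitTrunc n e = gitTrunc n e' := gitFn_injective (n := n) fun i hi => by
      rw [gitFn_gitTrunc, gitFn_gitTrunc, h]
    have h₂ := h (n + 1) le_rfl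
    rw [gitFn_self, gitFn_self] at h₂
    exact Subtype.ext (Prod.ext h₁ h₂)

/-- Every tuple of maps that commute with restrictions is encoded in `GITFns`. -/
theorem exists_gitFn_eq : ∀ {n : ℕ} (φ : ExpSt GIT.{u} GIT n),
    ∃ e : St GITFns.{u} n, ∀ i hi, gitFn e i hi = φ.fn i hi
  | 0, φ => ⟨φ.fn 0 le_rfl, fun i hi => by
      obtain rfl := Nat.le_zero.mp hi
      exact gitFn_self _⟩
  | n + 1, φ => by
    obtain ⟨e, he⟩ := exists_gitFn_eq (res (expObj GIT GIT) (Nat.le_succ n) φ)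
    have hlast : (gitStage n).last e = φ.fn n (Nat.le_succ n) :=
      (gitFn_self e).symm.trans (he n le_rfl)
    let e' : St GITFns.{u} (n + 1) := ⟨(e, φ.fn (n + 1) le_rfl), fun x => by
      change gitDown n (φ.fn (n + 1) le_rfl x) = (gitStage n).last e (gitDown n x)
      rw [hlast]
      exact (git_res_succ n _).symm.trans ((φ.comm (Nat.le_succ n) le_rfl x).symm.trans
        (congrArg (φ.fn n (Nat.le_succ n)) (git_res_succ n x)))⟩
    refine ⟨e', fun i hi => ?_⟩
    obtain hi' | rfl := Nat.le_succ_iff.mp hi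
    · exact (gitFn_gitTrunc e' i hi').symm.trans (he i hi')
    · exact gitFn_self e'

theorem gitExp_bijective (n : ℕ) :
    Function.Bijective (gitExp : St GITFns.{u} n → ExpSt (later.obj GIT) (later.obj GIT) (n + 1)) := by
  refine ⟨fun e e' h => gitFn_injective fun i hi => ?_, fun φ => ?_⟩
  · have := congrArg (fun ψ => ExpSt.fn ψ (i + 1) (Nat.succ_le_succ hi)) h
    exact this
  · obtain ⟨e, he⟩ := exists_gitFn_eq (n := n)
      ⟨fun i hi => φ.fn (i + 1) (Nat.succ_le_succ hi),
        fun hij hj x => φ.comm (Nat.succ_le_succ hij) (Nat.succ_le_succ hj) x⟩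
    refine ⟨e, expSt_ext fun i hi x => ?_⟩
    obtain _ | i := i
    · rfl
    · exact congrFun (he i (Nat.le_of_succ_le_succ hi)) x

theorem gitStr_bijective : ∀ n, Function.Bijective (gitStr.{u} n)
  | 0 => by
    refine Function.Bijective.sumMap Function.bijective_id ⟨fun _ _ _ => rfl, fun φ => ?_⟩
    refine ⟨PUnit.unit, expSt_ext fun i hi x => ?_⟩
    obtain rfl := Nat.le_zero.mp hi
    rfl
  | n + 1 => Function.Bijective.sumMap Function.bijective_id (gitExp_bijective n)

theorem isLocallyFinal_git : IsLocallyFinal Bu GIT.{u} git :=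
  haveI := isIso_of_bijective git gitStr_bijective
  isTerminal_of_isIso git

/-! ### The denotational model over a locally final coalgebra -/

/-- Evaluation of terms is internally functorial in the algebra structure: a tuple of compatible
maps `Σ X ⟶ X` extends to a tuple of compatible maps `Σ⋆ (X + X) ⟶ X`. -/
def evalTuple (X : ToT.{u}) : expObj (Su.obj X) X ⟶ expObj (freeU.star.obj (sm X X)) X :=
  mkHom (X := expObj (Su.obj X) X) (Y := expObj (freeU.star.obj (sm X X)) X)
    (fun n e => ⟨fun i hi t =>
        Term.eval (fun s : Sig (St X i) => ExpSt.fn e i hi s) (Sum.elim id id) t,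
      fun {i j} hij hj t => by
        refine (Term.eval_map _ _ _ t).trans ?_
        refine Eq.trans ?_ (Term.eval_hom _ (fun s : Sig (St X i) => ExpSt.fn e i (hij.trans hj) s)
          _ (res X hij) (fun s => (ExpSt.comm e hij hj s).symm) t).symm
        exact congrArg (fun v => Term.eval _ v t) (funext fun x => by rcases x with x | x <;> rfl)⟩)
    (fun _ _ => rfl)

theorem ap_codiag_hat {X : ToT.{u}} (a : Su.obj X ⟶ X) (n : ℕ) (t : Term (St X n ⊕ St X n)) :
    ap (freeU.star.map (codiag X) ≫ freeU.hat ⟨X, a⟩) n t =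
      Term.eval (ap a n) (Sum.elim id id) t := by
  refine (Term.eval_map (ap a n) _ _ t).trans ?_
  exact congrArg (fun v => Term.eval _ v t) (funext fun x => by rcases x with x | x <;> rfl)

/-- A locally final coalgebra extends to a bialgebra: the defining equation of the algebra
structure is guarded, as the law produces only delayed terms. -/
theorem exists_isBialgebra {Z : ToT.{u}} (z : Z ⟶ (Bu.obj (op Z)).obj Z) [IsIso z] :
    ∃ a : Su.obj Z ⟶ Z, IsBialgebra rhoU Z a z := by
  obtain ⟨a, ha⟩ := exists_guarded_corec z
    (Su.map (FunctorToTypes.prod.lift (𝟙 Z) z) ≫ rhoU.rho Z Z) (evalTuple Z)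
  refine ⟨a, (ha (freeU.star.map (codiag Z) ≫ freeU.hat ⟨Z, a⟩) fun n => ?_).trans
    (Category.assoc _ _ _)⟩
  exact expSt_ext fun i hi t => (ap_codiag_hat a i t).symm

/-- Primitive recursion over programs has at most one solution. -/
theorem primrec_unique {Y : ToT.{u}} {r : Su.obj (prd Mu Y) ⟶ Y} {k k' : Mu ⟶ Y}
    (hk : muAlg.str ≫ k = Su.map (FunctorToTypes.prod.lift (𝟙 Mu) k) ≫ r)
    (hk' : muAlg.str ≫ k' = Su.map (FunctorToTypes.prod.lift (𝟙 Mu) k') ≫ r) : k = k' := by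
  have key : ∀ l : Mu ⟶ Y, muAlg.str ≫ l = Su.map (FunctorToTypes.prod.lift (𝟙 Mu) l) ≫ r →
      ∀ n p, ap l n p = Term.para (ap r n) p := fun l hl n p => by
    refine Term.para_unique (ap r n) (ap l n) (fun t => ?_) p
    have h : ap (muAlg.str ≫ l) n t = _ := congrArg (fun k => ap k n t) hl
    refine h.trans (congrArg (ap r n) ?_)
    cases t <;> rfl
  exact hom_ext fun n p => (key k hk n p).trans (key k' hk' n p).symm

theorem codiag_naturality {X Y : ToT.{u}} (f : X ⟶ Y) : codiag X ≫ f = smMap f f ≫ codiag Y :=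
  hom_ext fun n x => by rcases x with x | x <;> rfl

theorem smMap_comp {X X' X'' Y Y' Y'' : ToT.{u}} (f : X ⟶ X') (f' : X' ⟶ X'') (g : Y ⟶ Y')
    (g' : Y' ⟶ Y'') : smMap f g ≫ smMap f' g' = smMap (f ≫ f') (g ≫ g') :=
  hom_ext fun n x => by rcases x with x | x <;> rfl

theorem hat_naturality {A A' : Endofunctor.Algebra Su.{u}} (k : A ⟶ A') :
    freeU.hat A ≫ k.f = freeU.star.map k.f ≫ freeU.hat A' :=
  hom_ext fun n t => (Term.eval_hom (ap A.str n) (ap A'.str n) _ (ap k.f n) (hom_alg k n) t).trans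
    (Term.eval_map (ap A'.str n) (ap (𝟙 A'.a) n) (ap k.f n) t).symm

/-- The unique algebra morphism from programs to a bialgebra is compatible with the coalgebra
structures: it is a coalgebra morphism from the operational model once inputs are restricted to
programs. Both sides are defined by the same primitive recursion, by naturality and dinaturality of
the law. -/
theorem den_coalgebra {Z : ToT.{u}} {a : Su.obj Z ⟶ Z} {z : Z ⟶ (Bu.obj (op Z)).obj Z}
    (h : IsBialgebra rhoU Z a z) :
    gamma ≫ (Bu.obj (op Mu)).map (den ⟨Z, a⟩) =
      den ⟨Z, a⟩ ≫ z ≫ (Bu.map (den ⟨Z, a⟩).op).app Z := by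
  have hden : muAlg.str ≫ den ⟨Z, a⟩ = Su.map (den ⟨Z, a⟩) ≫ a :=
    (muInitial.to ⟨Z, a⟩).h.symm
  have hhat : freeU.hat muAlg ≫ den ⟨Z, a⟩ = freeU.star.map (den ⟨Z, a⟩) ≫ freeU.hat ⟨Z, a⟩ :=
    hat_naturality (muInitial.to ⟨Z, a⟩)
  generalize den ⟨Z, a⟩ = d at *
  refine primrec_unique (r := rhoU.rho Mu Z ≫ (Bu.obj (op Mu)).map
    (freeU.star.map (smMap d (𝟙 Z)) ≫ freeU.star.map (codiag Z) ≫ freeU.hat ⟨Z, a⟩)) ?_ ?_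
  · have h₁ : (freeU.star.map (codiag Mu) ≫ freeU.hat muAlg) ≫ d =
        freeU.star.map (smMap (𝟙 Mu) d) ≫ freeU.star.map (smMap d (𝟙 Z)) ≫
          freeU.star.map (codiag Z) ≫ freeU.hat ⟨Z, a⟩ := by
      rw [Category.assoc, hhat, ← Category.assoc, ← Functor.map_comp, codiag_naturality,
        ← Category.assoc (freeU.star.map (smMap (𝟙 Mu) d)), ← Functor.map_comp, smMap_comp,
        Category.id_comp, Category.comp_id, Functor.map_comp, Category.assoc]
    have h₂ : FunctorToTypes.prod.lift (𝟙 Mu) gamma ≫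
        prdMap (𝟙 Mu) ((Bu.obj (op Mu)).map d) =
        FunctorToTypes.prod.lift (𝟙 Mu) (gamma ≫ (Bu.obj (op Mu)).map d) := rfl
    have hγ : muAlg.str ≫ gamma = _ := gamma_isBialgebra
    rw [← Category.assoc, hγ, Category.assoc, Category.assoc, ← Functor.map_comp, h₁,
      Functor.map_comp, ← Category.assoc (rhoU.rho Mu Mu), ← rhoU.natural, ← h₂]
    simp only [Category.assoc, Functor.map_comp]
  · have h₁ : Su.map d ≫ Su.map (FunctorToTypes.prod.lift (𝟙 Z) z) =
        Su.map (FunctorToTypes.prod.lift (𝟙 Mu) (d ≫ z)) ≫ Su.map (prdMap d (𝟙 _)) := by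
      rw [← Functor.map_comp, ← Functor.map_comp]
      rfl
    have h₂ : FunctorToTypes.prod.lift (𝟙 Mu) (d ≫ z) ≫ prdMap (𝟙 Mu) ((Bu.map d.op).app Z) =
        FunctorToTypes.prod.lift (𝟙 Mu) (d ≫ z ≫ (Bu.map d.op).app Z) := rfl
    have ha : a ≫ z = _ := h
    rw [← Category.assoc, hden, Category.assoc, ← Category.assoc a, ha, Category.assoc,
      Category.assoc, (Bu.map d.op).naturality, ← Category.assoc, h₁, Category.assoc,
      ← Category.assoc (rhoU.rho Z Z), ← Category.assoc (Su.map (prdMap d (𝟙 _))),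
      rhoU.dinatural, ← h₂]
    simp only [Category.assoc, Functor.map_comp]

/-- The factor of `beh` is the unique coalgebra morphism from the bialgebra, with inputs restricted
to programs, to the final coalgebra. -/
theorem isAdequate_of_isBialgebra {Z : ToT.{u}} {a : Su.obj Z ⟶ Z}
    {z : Z ⟶ (Bu.obj (op Z)).obj Z} (h : IsBialgebra rhoU Z a z) : IsAdequate ⟨Z, a⟩ := by
  intro N hN
  let C : Endofunctor.Coalgebra (Bu.obj (op Mu.{u})) := ⟨Z, z ≫ (Bu.map (den ⟨Z, a⟩).op).app Z⟩
  let k : opModel ⟶ C := ⟨den ⟨Z, a⟩, den_coalgebra h⟩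
  exact ⟨(hN.from C).f, congrArg Endofunctor.Coalgebra.Hom.f (hN.hom_ext (k ≫ hN.from C) _)⟩

/-! ### The final coalgebra for `B(μΣ, -)` -/

/-- Trees whose nodes are either unary or branch over all programs, cut off at depth `n`. -/
def ProgTree : ℕ → Type u
  | 0 => PUnit
  | n + 1 => ProgTree n ⊕ (Prog.{u} → ProgTree n)

/-- Truncation of trees. -/
def ProgTree.trunc : ∀ n, ProgTree.{u} (n + 1) → ProgTree n
  | 0 => fun _ => PUnit.unit
  | n + 1 => Sum.map (trunc n) fun f t => trunc n (f t)

/-- The presheaf `n ↦ ProgTree (n + 1)`; the index is shifted because `B(μΣ, -)` exposes one layer of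
a tree already at stage `0`. -/
def nuObj : ToT.{u} :=
  CategoryTheory.Functor.ofOpSequence (X := fun n => ProgTree.{u} (n + 1))
    (fun n => ↾(ProgTree.trunc (n + 1)))

theorem nuObj_res_succ (n : ℕ) (x : St nuObj.{u} (n + 1)) :
    res nuObj (Nat.le_succ n) x = ProgTree.trunc (n + 1) x := by
  have h := CategoryTheory.Functor.ofOpSequence_map_homOfLE_succ
    (X := fun n => ProgTree.{u} (n + 1)) (fun n => ↾(ProgTree.trunc.{u} (n + 1))) n
  exact congrArg (fun k : ProgTree.{u} (n + 2) ⟶ ProgTree.{u} (n + 1) => k x) h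

/-- The identification of `ProgTree n` with stage `n` of `▷ nuObj`. -/
def ProgTree.later : ∀ n, ProgTree.{u} n → St (later.obj nuObj.{u}) n
  | 0 => fun x => x
  | _ + 1 => fun x => x

theorem ProgTree.later_bijective : ∀ n, Function.Bijective (ProgTree.later.{u} n)
  | 0 => Function.bijective_id
  | _ + 1 => Function.bijective_id

theorem ProgTree.later_trunc : ∀ n (x : ProgTree.{u} (n + 1)),
    ProgTree.later n (ProgTree.trunc n x) =
      res (XCL.later.obj nuObj) (Nat.le_succ n) (ProgTree.later (n + 1) x)
  | 0, _ => rfl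
  | n + 1, x => (nuObj_res_succ n x).symm

/-- The element of `((▷ Y) ^ (▷ μΣ))_n` given by a map `Prog → ▷_n Y`. As `μΣ` is constant, all its
elements have this form. -/
def progExp (Y : ToT.{u}) (n : ℕ) (f : Prog.{u} → St (later.obj Y) n) :
    ExpSt (later.obj Mu) (later.obj Y) n where
  fn
    | 0, _ => fun _ => PUnit.unit
    | _ + 1, hi => fun t => res (later.obj Y) hi (f t)
  comm {i j} hij hj x :=
    match i, j, hij, hj, x with
    | 0, _, _, _, _ => rfl
    | _ + 1, _ + 1, hij, hj, x => (res_res (later.obj Y) hij hj (f x)).symm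

theorem progExp_fn (Y : ToT.{u}) (n : ℕ) (f : Prog.{u} → St (later.obj Y) n) :
    ∀ (i : ℕ) (hi : i ≤ n) (t : Prog.{u}),
    (progExp Y n f).fn i hi (next Mu i t) = res (later.obj Y) hi (f t)
  | 0, _, _ => rfl
  | _ + 1, _, _ => rfl

theorem next_Mu_surjective : ∀ (i : ℕ) (x : St (later.obj Mu.{u}) i), ∃ t : Prog.{u},
    next Mu i t = x
  | 0, _ => ⟨.I, rfl⟩
  | _ + 1, x => ⟨x, rfl⟩

theorem res_next_Mu {m n : ℕ} (h : m ≤ n) (t : Prog.{u}) :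
    res (later.obj Mu) h (next Mu n t) = next Mu m t :=
  (next_res Mu h t).symm

theorem progExp_bijective (Y : ToT.{u}) (n : ℕ) : Function.Bijective (progExp Y n) := by
  refine ⟨fun f g h => funext fun t => ?_, fun φ => ?_⟩
  · have := congrArg (fun ψ => ExpSt.fn ψ n le_rfl (next Mu n t)) h
    simpa only [progExp_fn, res_refl] using this
  · refine ⟨fun t => φ.fn n le_rfl (next Mu n t), expSt_ext fun i hi x => ?_⟩
    obtain ⟨t, rfl⟩ := next_Mu_surjective i x
    rw [progExp_fn, ← φ.comm hi le_rfl, res_next_Mu]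

/-- The components of the coalgebra structure on `nuObj`. -/
def nuStr (n : ℕ) : ProgTree.{u} n ⊕ (Prog.{u} → ProgTree n) →
    St ((Bu.obj (op Mu)).obj nuObj.{u}) n :=
  Sum.map (ProgTree.later n) fun f => progExp nuObj n fun t => ProgTree.later n (f t)

theorem nuStr_bijective (n : ℕ) : Function.Bijective (nuStr.{u} n) :=
  (ProgTree.later_bijective n).sumMap
    ((progExp_bijective nuObj n).comp (ProgTree.later_bijective n).comp_left)

theorem nuStr_succ (n : ℕ) (x : St nuObj.{u} (n + 1)) :
    nuStr n (res nuObj (Nat.le_succ n) x) =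
      res ((Bu.obj (op Mu)).obj nuObj) (Nat.le_succ n) (nuStr (n + 1) x) := by
  rw [nuObj_res_succ]
  obtain x | f := (show ProgTree (n + 1) ⊕ (Prog.{u} → ProgTree (n + 1)) from x)
  · exact congrArg Sum.inl (ProgTree.later_trunc n x)
  · refine congrArg Sum.inr (expSt_ext fun i hi x => ?_)
    obtain ⟨t, rfl⟩ := next_Mu_surjective i x
    refine (progExp_fn _ _ _ i hi t).trans ?_
    refine Eq.trans ?_ (progExp_fn _ _ _ i (hi.trans (Nat.le_succ n)) t).symm
    rw [ProgTree.later_trunc, res_res]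

/-- The final coalgebra for `B(μΣ, -)`. -/
def nuCoalg : Endofunctor.Coalgebra (Bu.obj (op Mu.{u})) where
  V := nuObj
  str := mkHom (X := nuObj) (Y := (Bu.obj (op Mu)).obj nuObj) nuStr (fun {m n} h x => by
    induction n, h using Nat.le_induction with
    | base =>
      rw [res_refl]
      exact (res_refl ((Bu.obj (op Mu)).obj nuObj) _ _).symm
    | succ n h ih =>
      rw [← res_res nuObj h (Nat.le_succ n), ih, nuStr_succ]
      exact res_res ((Bu.obj (op Mu)).obj nuObj) h (Nat.le_succ n) _)

theorem hasTerminal_coalgebra : Limits.HasTerminal (Endofunctor.Coalgebra (Bu.obj (op Mu.{u}))) :=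
  haveI := isIso_of_bijective nuCoalg.str nuStr_bijective
  (isTerminal_of_isIso nuCoalg.{u}.str).some.hasTerminal

/-! ### The operational model and the transition rules -/

/-- The transition function of xCL: a program either reduces or consumes an input. -/
def step : Prog.{u} → Prog.{u} ⊕ (Prog.{u} → Prog.{u})
  | .var x => x.elim
  | .S => .inr .S₁
  | .K => .inr .K₁
  | .I => .inr id
  | .S₁ p => .inr (.S₂ p)
  | .K₁ p => .inr fun _ => p
  | .S₂ p q => .inr fun t => .app (.app p t) (.app q t)
  | .app p q => .inl ((step p).elim (fun p' => .app p' q) fun f => f q)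

theorem red_and_lab_iff (p : Prog.{u}) : (∀ p', Red p p' ↔ step p = .inl p') ∧
    ∀ t p', Lab p t p' ↔ ∃ f, step p = .inr f ∧ f t = p' := by
  induction p with
  | var x => exact x.elim
  | app p q ihp ihq =>
    refine ⟨fun p' => ⟨?_, fun h => ?_⟩, fun t p' => ⟨nofun, ?_⟩⟩
    · rintro (⟨_, h⟩ | h)
      · rw [ihp.1] at h
        simp [step, h]
      · obtain ⟨f, hf, rfl⟩ := (ihp.2 _ _).1 h
        simp [step, hf]
    · rcases hp : step p with p₁ | f
      · simp only [step, hp, Sum.elim_inl, Sum.inl.injEq] at h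
        exact h ▸ .left q ((ihp.1 _).2 hp)
      · simp only [step, hp, Sum.elim_inr, Sum.inl.injEq] at h
        exact h ▸ .beta ((ihp.2 _ _).2 ⟨f, hp, rfl⟩)
    · simp [step]
  | _ =>
    refine ⟨fun p' => ⟨nofun, by simp [step]⟩, fun t p' => ⟨?_, ?_⟩⟩
    · rintro ⟨⟩
      exact ⟨_, rfl, rfl⟩
    · rintro ⟨_, ⟨⟩, rfl⟩
      constructor

theorem inr_eq_progExp {n : ℕ} {φ : ExpSt (later.obj Mu.{u}) (later.obj Mu) n}
    {f : Prog.{u} → Prog.{u}}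
    (h : ∀ i (hi : i ≤ n) (t : Prog.{u}), φ.fn i hi (next Mu i t) = next Mu i (f t)) :
    (.inr φ : St BMu.{u} n) = .inr (progExp Mu n fun t => next Mu n (f t)) := by
  refine congrArg Sum.inr (expSt_ext fun i hi x => ?_)
  obtain ⟨t, rfl⟩ := next_Mu_surjective i x
  rw [h, progExp_fn, res_next_Mu]

/-- The operational model implements the transition rules: transitions are delayed by one step. -/
theorem gamma_eq_step (n : ℕ) (p : Prog.{u}) : ap gamma n p =
    (step p).map (next Mu n) fun f => progExp Mu n fun t => next Mu n (f t) := by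
  induction p with
  | var x => exact x.elim
  | app p q ihp _ =>
    have h : ap gamma n (.app p q) =
      ap gammaStep n (.app (p, ap gamma n p) (q, ap gamma n q)) := rfl
    rw [h, ihp]
    simp only [step]
    rcases step p with p' | f
    · cases n <;> rfl
    · cases n with
      | zero => rfl
      | succ n => exact congrArg Sum.inl (progExp_fn Mu (n + 1) _ (n + 1) le_rfl q)
  | S => exact inr_eq_progExp fun i hi t => by cases i <;> rfl
  | K => exact inr_eq_progExp fun i hi t => by cases i <;> rfl
  | I => exact inr_eq_progExp fun i hi t => by cases i <;> rfl
  | S₁ p => exact inr_eq_progExp fun i hi t => by cases i <;> rfl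
  | K₁ p => exact inr_eq_progExp fun i hi t => by cases i <;> rfl
  | S₂ p q => exact inr_eq_progExp fun i hi t => by cases i <;> rfl

/-! ### Step-indexed bisimilarity and behavioural equivalence -/

theorem stepBisim_iff_stepRel {n : ℕ} {p q : Prog.{u}} : StepBisim n p q ↔ StepRel n p q :=
  ⟨fun ⟨_, hR, h⟩ => hR.le_stepRel n p q h, fun h => ⟨_, stepRel_isStepBisim, h⟩⟩

/-- The lifting of a relation to results of the transition function `step`: both are reductions to
related programs, or both are functions with related values. -/
def StepLift (R : Prog.{u} → Prog.{u} → Prop) :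
    Prog.{u} ⊕ (Prog.{u} → Prog.{u}) → Prog.{u} ⊕ (Prog.{u} → Prog.{u}) → Prop :=
  Sum.LiftRel R fun f g => ∀ t, R (f t) (g t)

/-- As transitions are deterministic and no program is stuck, the symmetric one-step condition of
bisimilarity says that the results of the transition function are related. -/
theorem oneStep_and_iff {R : Prog.{u} → Prog.{u} → Prop} (hR : Equivalence R) (p q : Prog.{u}) :
    OneStep R p q ∧ OneStep R q p ↔ StepLift R (step p) (step q) := by
  simp only [OneStep, red_and_lab_iff, StepLift]
  rcases step p with p' | f <;> rcases step q with q' | g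
  · simpa using fun h => hR.symm h
  · simp
  · simp
  · simpa using fun h t => hR.symm (h t)

theorem stepRel_succ_iff {n : ℕ} {p q : Prog.{u}} :
    StepRel (n + 1) p q ↔ StepLift (StepRel n) (step p) (step q) := by
  rw [StepRel, oneStep_and_iff (stepRel_isStepBisim.equiv n)]
  refine ⟨fun h => h.2, fun h => ⟨?_, h⟩⟩
  induction n generalizing p q with
  | zero => trivial
  | succ n ih =>
    have h' : StepLift (StepRel n) (step p) (step q) :=
      Sum.LiftRel.mono (fun _ _ h => h.1) (fun _ _ h t => (h t).1) h
    exact ⟨ih h', (oneStep_and_iff (stepRel_isStepBisim.equiv n) p q).2 h'⟩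

theorem map_eq_map_iff_stepLift {A B : Type*} (α : Prog.{u} → A) {β : (Prog.{u} → A) → B}
    (hβ : Function.Injective β) (x y : Prog.{u} ⊕ (Prog.{u} → Prog.{u})) :
    x.map α (fun f => β fun t => α (f t)) = y.map α (fun f => β fun t => α (f t)) ↔
      StepLift (fun p q => α p = α q) x y := by
  rcases x with p | f <;> rcases y with q | g <;> simp [StepLift, hβ.eq_iff, funext_iff]

/-- Behavioural equivalence unfolds along the transition function. -/
theorem beh_eq_iff (N : Endofunctor.Coalgebra (Bu.obj (op Mu.{u}))) (hN : Limits.IsTerminal N)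
    (n : ℕ) (p q : Prog.{u}) :
    ap (beh N hN) n p = ap (beh N hN) n q ↔
      StepLift (fun p' q' => ap (later.map (beh N hN)) n (next Mu n p') =
        ap (later.map (beh N hN)) n (next Mu n q')) (step p) (step q) := by
  have hinj : Function.Injective (ap N.str n) := by
    have := Endofunctor.Coalgebra.Terminal.str_isIso hN
    intro x y h
    have := congrArg (ap (inv N.str) n) h
    simpa only [← ap_comp, IsIso.hom_inv_id, ap_id] using this
  have hbeh : ∀ p : Prog.{u}, ap N.str n (ap (beh N hN) n p) =
      (step p).map (fun p' => ap (later.map (beh N hN)) n (next Mu n p'))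
        fun f => progExp N.V n fun t => ap (later.map (beh N hN)) n (next Mu n (f t)) := by
    intro p
    have h : ap (beh N hN ≫ N.str) n p = ap (gamma ≫ (Bu.obj (op Mu)).map (beh N hN)) n p :=
      congrArg (fun k : Mu ⟶ (Bu.obj (op Mu)).obj N.V => ap k n p) (hN.from opModel).h.symm
    refine h.trans ?_
    refine (congrArg (ap ((Bu.obj (op Mu)).map (beh N hN)) n) (gamma_eq_step n p)).trans ?_
    rcases step p with p' | f
    · rfl
    · refine congrArg Sum.inr (expSt_ext fun i hi x => ?_)
      obtain ⟨t, rfl⟩ := next_Mu_surjective i x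
      refine (congrArg (ap (later.map (beh N hN)) i) (progExp_fn Mu n _ i hi t)).trans ?_
      rw [ap_res, progExp_fn]
  rw [← hinj.eq_iff, hbeh, hbeh]
  exact map_eq_map_iff_stepLift _ (progExp_bijective N.V n).injective _ _

theorem beh_eq_iff_stepBisim (N : Endofunctor.Coalgebra (Bu.obj (op Mu.{u})))
    (hN : Limits.IsTerminal N) (n : ℕ) (p q : Prog.{u}) :
    ap (beh N hN) n p = ap (beh N hN) n q ↔ StepBisim (n + 1) p q := by
  rw [stepBisim_iff_stepRel]
  induction n generalizing p q with
  | zero =>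
    rw [beh_eq_iff, stepRel_succ_iff]
    exact iff_of_eq (congrArg (fun R => StepLift R _ _) (funext₂ fun _ _ => eq_true rfl))
  | succ n ih =>
    rw [beh_eq_iff, stepRel_succ_iff]
    exact iff_of_eq (congrArg (fun R => StepLift R _ _) (funext₂ fun p' q' => propext (ih p' q')))

end XCL

theorem mainTheorem5 :
    -- guarded interaction trees form a locally final coalgebra
    IsLocallyFinal Bu GIT.{u} git ∧
    -- every locally final coalgebra extends to an adequate denotational model
    (∀ (Z : ToT.{u}) (z : Z ⟶ (Bu.obj (op Z)).obj Z), IsLocallyFinal Bu Z z →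
      ∃ a : Su.obj Z ⟶ Z, IsDenotationalModel rhoU Z a z ∧ IsAdequate ⟨Z, a⟩ ∧
        ∀ (n : ℕ) (p q : Prog.{u}),
          ap (den ⟨Z, a⟩) n p = ap (den ⟨Z, a⟩) n q → StepBisim n p q) ∧
    -- behavioural equivalence on the operational model is step-indexed bisimilarity
    Limits.HasTerminal (Endofunctor.Coalgebra (Bu.obj (op Mu.{u}))) ∧
    (∀ (N : Endofunctor.Coalgebra (Bu.obj (op Mu.{u}))) (hN : Limits.IsTerminal N)
      (n : ℕ) (p q : Prog.{u}),
      ap (beh N hN) n p = ap (beh N hN) n q ↔ StepBisim (n + 1) p q) := by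
  refine ⟨isLocallyFinal_git, fun Z z hz => ?_, hasTerminal_coalgebra, beh_eq_iff_stepBisim⟩
  obtain ⟨hterm⟩ := hz
  have : IsIso z := Endofunctor.Coalgebra.Terminal.str_isIso hterm
  obtain ⟨a, ha⟩ := exists_isBialgebra z
  refine ⟨a, ⟨ha, ⟨hterm⟩⟩, isAdequate_of_isBialgebra ha, fun n p q hpq => ?_⟩
  have := hasTerminal_coalgebra.{u}
  obtain ⟨k, hk⟩ := isAdequate_of_isBialgebra ha _ Limits.terminalIsTerminal
  have hbeh := (beh_eq_iff_stepBisim _ Limits.terminalIsTerminal n p q).1 <| by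
    rw [← hk]
    exact congrArg (ap k n) hpq
  exact stepBisim_iff_stepRel.2 (stepBisim_iff_stepRel.1 hbeh).1
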